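/- Let $h\ge 0$ and let $A_0,A_1\in\mathbb R^{n\times n}$, $C_d\in\mathbb R^{n\times n_d}$, $A_d\in\mathbb R^{n_d\times n_d}$, $B_d\in\mathbb R^{n_d\times n}$ be constant matrices. Put $A_D(\theta)=C_d e^{A_d\theta}B_d$ and consider the time-delay system $\dot x(t)=A_0x(t)+A_1x(t-h)+\int_{-h}^0A_D(\theta)x(t+\theta)\,d\theta$. Its spectrum is $$\Lambda=\Big\{\lambda\in\mathbb C:\det\Big(\lambda I-A_0-e^{-\lambda h}A_1-\int_{-h}^0e^{\lambda\theta}A_D(\theta)\,d\theta\Big)=0\Big\},$$ and the spectrum condition says that $-\lambda\notin\Lambda$ for every $\lambda\in\Lambda$. For $Q\in\mathbb R^{n\times n}$, the ODEc is the following system for functions on $\mathbb R$, where $\Omega_1,\Omega_2$ are $n\times n$, $\Omega_3,\Omega_4$ are $n\times n_d$ and $\Omega_5,\Omega_6$ are $n_d\times n$: $$\begin{aligned} \dot\Omega_1&=\Omega_1A_0+\Omega_2A_1+\Omega_3B_d+\Omega_4B_d, & \dot\Omega_2&=-A_1^{\top}\Omega_1-A_0^{\top}\Omega_2-B_d^{\top}\Omega_5-B_d^{\top}\Omega_6,\\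 \dot\Omega_3&=-\Omega_3A_d+\Omega_1C_d, & \dot\Omega_4&=-\Omega_4A_d-\Omega_2C_de^{-A_dh},\\ \dot\Omega_5&=A_d^{\top}\Omega_5+(C_de^{-A_dh})^{\top}\Omega_1, & \dot\Omega_6&=A_d^{\top}\Omega_6-C_d^{\top}\Omega_2, \end{aligned}$$ with the boundary conditions $$-Q=\Omega_1(0)A_0+\Omega_2(0)A_1+\Omega_4(0)B_d+A_1^{\top}\Omega_1(h)+A_0^{\top}\Omega_2(h)+B_d^{\top}\Omega_5(h),$$ $$\Omega_1(0)-\Omega_2(h)=\mathbf 0,\quad \Omega_3(0)=\mathbf 0,\quad \Omega_4(h)=\mathbf 0,\quad \Omega_5(0)=\mathbf 0,\quad \Omega_6(h)=\mathbf 0.$$ Let $n_s=2n^2+4nn_d$, let $\mathrm{vec}$ stack the columns of a matrix, write $G=C_de^{-A_dh}$, and define the $n_s\times n_s$ matrices $$E=\begin{bmatrix}A_0^{\top}\otimes I_n&A_1^{\top}\otimes I_n&B_d^{\top}\otimes I_n&B_d^{\top}\otimes I_n&\mathbf 0&\mathbf 0\\-I_n\otimes A_1^{\top}&-I_n\otimes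 A_0^{\top}&\mathbf 0&\mathbf 0&-I_n\otimes B_d^{\top}&-I_n\otimes B_d^{\top}\\C_d^{\top}\otimes I_n&\mathbf 0&-A_d^{\top}\otimes I_n&\mathbf 0&\mathbf 0&\mathbf 0\\\mathbf 0&-G^{\top}\otimes I_n&\mathbf 0&-A_d^{\top}\otimes I_n&\mathbf 0&\mathbf 0\\I_n\otimes G^{\top}&\mathbf 0&\mathbf 0&\mathbf 0&I_n\otimes A_d^{\top}&\mathbf 0\\\mathbf 0&-I_n\otimes C_d^{\top}&\mathbf 0&\mathbf 0&\mathbf 0&I_n\otimes A_d^{\top}\end{bmatrix},$$ $$F_1=\begin{bmatrix}A_0^{\top}\otimes I_n&A_1^{\top}\otimes I_n&B_d^{\top}\otimes I_n&B_d^{\top}\otimes I_n&\mathbf 0&\mathbf 0\\I_n\otimes I_n&\mathbf 0&\mathbf 0&\mathbf 0&\mathbf 0&\mathbf 0\\\mathbf 0&\mathbf 0&I_{n_d}\otimes I_n&\mathbf 0&\mathbf 0&\mathbf 0\\\mathbf 0&\mathbf 0&\mathbf 0&\mathbf 0&I_n\otimes I_{n_d}&\mathbf 0\\\mathbf 0&\mathbf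 0&\mathbf 0&\mathbf 0&\mathbf 0&\mathbf 0\\\mathbf 0&\mathbf 0&\mathbf 0&\mathbf 0&\mathbf 0&\mathbf 0\end{bmatrix},$$ $$F_2=\begin{bmatrix}I_n\otimes A_1^{\top}&I_n\otimes A_0^{\top}&\mathbf 0&\mathbf 0&I_n\otimes B_d^{\top}&I_n\otimes B_d^{\top}\\\mathbf 0&-I_n\otimes I_n&\mathbf 0&\mathbf 0&\mathbf 0&\mathbf 0\\\mathbf 0&\mathbf 0&\mathbf 0&\mathbf 0&\mathbf 0&\mathbf 0\\\mathbf 0&\mathbf 0&\mathbf 0&\mathbf 0&\mathbf 0&\mathbf 0\\\mathbf 0&\mathbf 0&\mathbf 0&I_{n_d}\otimes I_n&\mathbf 0&\mathbf 0\\\mathbf 0&\mathbf 0&\mathbf 0&\mathbf 0&\mathbf 0&I_n\otimes I_{n_d}\end{bmatrix}.$$ For $\Omega=(\Omega_1,\dots,\Omega_6)$ let $\mathrm{vec}\,\Omega(\tau)\in\mathbb R^{n_s}$ be the column formed by $\mathrm{vec}\,\Omega_1(\tau),\dots,\mathrm{vec}\,\Omega_6(\tau)$, and let $b_Q=(-\mathrm{vec}(Q);0;\dots;0)\in\mathbb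 R^{n_s}$. Then: 1. For every $Q\in\mathbb R^{n\times n}$, $\Omega$ is a solution of the ODEc if and only if $\mathrm{vec}\,\Omega(\tau)=e^{E\tau}\,\mathrm{vec}\,\Omega(0)$ for all $\tau\in\mathbb R$ and $(F_1+F_2e^{Eh})\,\mathrm{vec}\,\Omega(0)=b_Q$. 2. The matrix $F_1+F_2e^{Eh}$ is nonsingular if and only if the spectrum condition holds. 3. If the spectrum condition holds, then for every $Q=Q^{\top}\in\mathbb R^{n\times n}$ the linear system $(F_1+F_2e^{Eh})v=b_Q$ has exactly one solution $v_0$, the delay system $$\dot P(\tau)=P(\tau)A_0+P(\tau-h)A_1+\int_{-h}^0P(\tau+\theta)A_D(\theta)\,d\theta,\qquad P(-\tau)=P(\tau)^{\top}\qquad(\tau\in[0,h]),$$ $$-Q=A_0^{\top}P(0)+P(0)A_0+A_1^{\top}P(h)+P(-h)A_1+\int_{-h}^0\big[A_D(\theta)^{\top}P(-\theta)+P(\theta)A_D(\theta)\big]d\theta$$ (with one-sided derivatives at the ends of $[0,h]$) has exactly one solution $P$ on $[-h,h]$, and for $\tau\in[0,h]$ the vector $\mathrm{vec}\,P(\tau)$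 is the first block (the first $n^2$ entries) of $e^{E\tau}v_0$. -/

import Mathlib

open scoped Matrix Kronecker

noncomputable section

/-- Data of the time-delay system
`x'(t) = A₀ x(t) + A₁ x(t - h) + ∫ θ in -h..0, A_D(θ) x(t + θ)`,
with `A_D(θ) = C_d e^{A_d θ} B_d`, `x(t) ∈ ℝⁿ`, and delay `h ≥ 0`. -/
structure DelaySystem (n d : ℕ) where
  A₀ : Matrix (Fin n) (Fin n) ℝ
  A₁ : Matrix (Fin n) (Fin n) ℝ
  Ad : Matrix (Fin d) (Fin d) ℝ
  Bd : Matrix (Fin d) (Fin n) ℝ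
  Cd : Matrix (Fin n) (Fin d) ℝ
  h : ℝ
  h_nonneg : 0 ≤ h

/-- The entrywise derivative at `τ` of a matrix-valued function of a real variable. -/
def MatHasDerivAt {p q : ℕ} (f : ℝ → Matrix (Fin p) (Fin q) ℝ)
    (f' : Matrix (Fin p) (Fin q) ℝ) (τ : ℝ) : Prop :=
  ∀ i j, HasDerivAt (fun s => f s i j) (f' i j) τ

/-- The entrywise derivative at `τ` relative to a set (one-sided at the ends of an interval). -/
def MatHasDerivWithinAt {p q : ℕ} (f : ℝ → Matrix (Fin p) (Fin q) ℝ)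
    (f' : Matrix (Fin p) (Fin q) ℝ) (s : Set ℝ) (τ : ℝ) : Prop :=
  ∀ i j, HasDerivWithinAt (fun t => f t i j) (f' i j) s τ

/-- The entrywise integral of a matrix-valued function. -/
def matIntegral {p q : ℕ} (f : ℝ → Matrix (Fin p) (Fin q) ℝ) (a b : ℝ) :
    Matrix (Fin p) (Fin q) ℝ :=
  Matrix.of fun i j => ∫ θ in a..b, f θ i j

/-- Six matrix-valued functions `Ω₁, …, Ω₆`, the unknowns of the auxiliary system. -/
structure AuxTrajectory (n d : ℕ) where
  Ω₁ : ℝ → Matrix (Fin n) (Fin n) ℝ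
  Ω₂ : ℝ → Matrix (Fin n) (Fin n) ℝ
  Ω₃ : ℝ → Matrix (Fin n) (Fin d) ℝ
  Ω₄ : ℝ → Matrix (Fin n) (Fin d) ℝ
  Ω₅ : ℝ → Matrix (Fin d) (Fin n) ℝ
  Ω₆ : ℝ → Matrix (Fin d) (Fin n) ℝ

/-- The dimension `n_s = 2 n² + 4 n n_d` of the auxiliary system. -/
abbrev auxDim (n d : ℕ) : ℕ := 2 * n ^ 2 + 4 * n * d

/-- Indices of the six blocks `vec Ω₁, …, vec Ω₆` of the stacked state. -/
abbrev StateIdx (n d : ℕ) : Type :=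
  (Fin n × Fin n) ⊕ (Fin n × Fin n) ⊕ (Fin d × Fin n) ⊕ (Fin d × Fin n) ⊕
    (Fin n × Fin d) ⊕ (Fin n × Fin d)

/-- Indices of the six blocks of boundary equations: the algebraic condition involving `Q`, the
condition on `Ω₁(0) - Ω₂(h)`, and those on `Ω₃(0)`, `Ω₅(0)`, `Ω₄(h)`, `Ω₆(h)`, in this order. -/
abbrev RowIdx (n d : ℕ) : Type :=
  (Fin n × Fin n) ⊕ (Fin n × Fin n) ⊕ (Fin d × Fin n) ⊕ (Fin n × Fin d) ⊕
    (Fin d × Fin n) ⊕ (Fin n × Fin d)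

/-- Consecutive numbering of six blocks of indices; inside a block, `(j, i)` (column `j`, row `i`)
is numbered in column-stacking order. -/
def flatten₆ (a₁ b₁ a₂ b₂ a₃ b₃ a₄ b₄ a₅ b₅ a₆ b₆ : ℕ) :
    ((Fin a₁ × Fin b₁) ⊕ (Fin a₂ × Fin b₂) ⊕ (Fin a₃ × Fin b₃) ⊕ (Fin a₄ × Fin b₄) ⊕
      (Fin a₅ × Fin b₅) ⊕ (Fin a₆ × Fin b₆)) ≃
    Fin (a₁ * b₁ + (a₂ * b₂ + (a₃ * b₃ + (a₄ * b₄ + (a₅ * b₅ + a₆ * b₆))))) :=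
  (Equiv.sumCongr finProdFinEquiv <|
    (Equiv.sumCongr finProdFinEquiv <|
      (Equiv.sumCongr finProdFinEquiv <|
        (Equiv.sumCongr finProdFinEquiv <|
          (Equiv.sumCongr finProdFinEquiv finProdFinEquiv).trans finSumFinEquiv).trans
            finSumFinEquiv).trans finSumFinEquiv).trans finSumFinEquiv).trans finSumFinEquiv

/-- The numbering of the entries of the stacked state by `0, …, n_s - 1`. -/
def stateEquiv (n d : ℕ) : StateIdx n d ≃ Fin (auxDim n d) :=
  (flatten₆ n n n n d n d n n d n d).trans (finCongr (by unfold auxDim; ring))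

/-- The numbering of the scalar boundary equations by `0, …, n_s - 1`. -/
def rowEquiv (n d : ℕ) : RowIdx n d ≃ Fin (auxDim n d) :=
  (flatten₆ n n n n d n n d d n n d).trans (finCongr (by unfold auxDim; ring))

/-- Six vectors on top of each other. -/
def stack₆ {α₁ α₂ α₃ α₄ α₅ α₆ : Type} (v₁ : α₁ → ℝ) (v₂ : α₂ → ℝ) (v₃ : α₃ → ℝ) (v₄ : α₄ → ℝ)
    (v₅ : α₅ → ℝ) (v₆ : α₆ → ℝ) : α₁ ⊕ α₂ ⊕ α₃ ⊕ α₄ ⊕ α₅ ⊕ α₆ → ℝ :=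
  Sum.elim v₁ (Sum.elim v₂ (Sum.elim v₃ (Sum.elim v₄ (Sum.elim v₅ v₆))))

/-- A row of six blocks. -/
def cols₆ {ρ α₁ α₂ α₃ α₄ α₅ α₆ : Type} (M₁ : Matrix ρ α₁ ℝ) (M₂ : Matrix ρ α₂ ℝ)
    (M₃ : Matrix ρ α₃ ℝ) (M₄ : Matrix ρ α₄ ℝ) (M₅ : Matrix ρ α₅ ℝ) (M₆ : Matrix ρ α₆ ℝ) :
    Matrix ρ (α₁ ⊕ α₂ ⊕ α₃ ⊕ α₄ ⊕ α₅ ⊕ α₆) ℝ :=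
  Matrix.fromCols M₁ <| Matrix.fromCols M₂ <| Matrix.fromCols M₃ <|
    Matrix.fromCols M₄ <| Matrix.fromCols M₅ M₆

/-- Six block rows on top of each other. -/
def rows₆ {κ β₁ β₂ β₃ β₄ β₅ β₆ : Type} (M₁ : Matrix β₁ κ ℝ) (M₂ : Matrix β₂ κ ℝ)
    (M₃ : Matrix β₃ κ ℝ) (M₄ : Matrix β₄ κ ℝ) (M₅ : Matrix β₅ κ ℝ) (M₆ : Matrix β₆ κ ℝ) :
    Matrix (β₁ ⊕ β₂ ⊕ β₃ ⊕ β₄ ⊕ β₅ ⊕ β₆) κ ℝ :=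
  Matrix.fromRows M₁ <| Matrix.fromRows M₂ <| Matrix.fromRows M₃ <|
    Matrix.fromRows M₄ <| Matrix.fromRows M₅ M₆

/-- The column `(vec Ω₁(τ); …; vec Ω₆(τ))`. -/
def AuxTrajectory.stacked {n d : ℕ} (ω : AuxTrajectory n d) (τ : ℝ) : Fin (auxDim n d) → ℝ :=
  stack₆ (ω.Ω₁ τ).vec (ω.Ω₂ τ).vec (ω.Ω₃ τ).vec (ω.Ω₄ τ).vec (ω.Ω₅ τ).vec (ω.Ω₆ τ).vec ∘
    (stateEquiv n d).symm

/-- The `n × n` matrix `Ω₁` whose `vec` is the first block of a stacked state. -/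
def firstBlock {n d : ℕ} (v : Fin (auxDim n d) → ℝ) : Matrix (Fin n) (Fin n) ℝ :=
  Matrix.of fun i j => v (stateEquiv n d (Sum.inl (j, i)))

/-- The column `(-vec Q; 0; …; 0)`. -/
def boundaryRhs {n : ℕ} (d : ℕ) (Q : Matrix (Fin n) (Fin n) ℝ) : Fin (auxDim n d) → ℝ :=
  stack₆ (-Q.vec) 0 0 0 0 0 ∘ (rowEquiv n d).symm

namespace DelaySystem

variable {n d : ℕ} (S : DelaySystem n d)

/-- The kernel `A_D(θ) = C_d e^{A_d θ} B_d` of the distributed delay. -/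
def AD (θ : ℝ) : Matrix (Fin n) (Fin n) ℝ :=
  S.Cd * NormedSpace.exp (θ • S.Ad) * S.Bd

/-- The matrix `C_d e^{-A_d h}`. -/
def CdExp : Matrix (Fin n) (Fin d) ℝ :=
  S.Cd * NormedSpace.exp (-(S.h • S.Ad))

/-- The characteristic matrix
`λ I - A₀ - e^{-λ h} A₁ - ∫ θ in -h..0, e^{λ θ} A_D(θ)` at `λ = z`. -/
def charMatrix (z : ℂ) : Matrix (Fin n) (Fin n) ℂ :=
  z • (1 : Matrix (Fin n) (Fin n) ℂ) - S.A₀.map Complex.ofReal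
    - Complex.exp (-(z * (S.h : ℂ))) • S.A₁.map Complex.ofReal
    - Matrix.of fun i j => ∫ θ in (-S.h)..0, Complex.exp (z * (θ : ℂ)) * ((S.AD θ i j : ℝ) : ℂ)

/-- The spectrum `Λ` of the time-delay system. -/
def spectrumSet : Set ℂ :=
  {z | (S.charMatrix z).det = 0}

/-- The spectrum condition: `-λ ∉ Λ` for all `λ ∈ Λ`. -/
def SpectrumCondition : Prop :=
  ∀ z ∈ S.spectrumSet, -z ∉ S.spectrumSet

/-- Solutions of the delay differential equation with coupling conditions, for the matrix `Q`.
Only the values of `P` on `[-h, h]` matter. -/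
structure IsDDEcSolution (Q : Matrix (Fin n) (Fin n) ℝ) (P : ℝ → Matrix (Fin n) (Fin n) ℝ) :
    Prop where
  dynamics : ∀ τ ∈ Set.Icc 0 S.h, MatHasDerivWithinAt P
    (P τ * S.A₀ + P (τ - S.h) * S.A₁ + matIntegral (fun θ => P (τ + θ) * S.AD θ) (-S.h) 0)
    (Set.Icc 0 S.h) τ
  symmetry : ∀ τ ∈ Set.Icc 0 S.h, P (-τ) = (P τ)ᵀ
  algebraic : -Q = S.A₀ᵀ * P 0 + P 0 * S.A₀ + S.A₁ᵀ * P S.h + P (-S.h) * S.A₁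
    + matIntegral (fun θ => (S.AD θ)ᵀ * P (-θ) + P θ * S.AD θ) (-S.h) 0

/-- Solutions of the auxiliary ordinary differential equation with coupled split-boundary
conditions, for the matrix `Q`. -/
structure IsODEcSolution (Q : Matrix (Fin n) (Fin n) ℝ) (ω : AuxTrajectory n d) : Prop where
  ode₁ : ∀ τ, MatHasDerivAt ω.Ω₁
    (ω.Ω₁ τ * S.A₀ + ω.Ω₂ τ * S.A₁ + ω.Ω₃ τ * S.Bd + ω.Ω₄ τ * S.Bd) τ
  ode₂ : ∀ τ, MatHasDerivAt ω.Ω₂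
    (-(S.A₁ᵀ * ω.Ω₁ τ) - S.A₀ᵀ * ω.Ω₂ τ - S.Bdᵀ * ω.Ω₅ τ - S.Bdᵀ * ω.Ω₆ τ) τ
  ode₃ : ∀ τ, MatHasDerivAt ω.Ω₃ (-(ω.Ω₃ τ * S.Ad) + ω.Ω₁ τ * S.Cd) τ
  ode₄ : ∀ τ, MatHasDerivAt ω.Ω₄ (-(ω.Ω₄ τ * S.Ad) - ω.Ω₂ τ * S.CdExp) τ
  ode₅ : ∀ τ, MatHasDerivAt ω.Ω₅ (S.Adᵀ * ω.Ω₅ τ + S.CdExpᵀ * ω.Ω₁ τ) τ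
  ode₆ : ∀ τ, MatHasDerivAt ω.Ω₆ (S.Adᵀ * ω.Ω₆ τ - S.Cdᵀ * ω.Ω₂ τ) τ
  algebraic : -Q = ω.Ω₁ 0 * S.A₀ + ω.Ω₂ 0 * S.A₁ + ω.Ω₄ 0 * S.Bd
    + S.A₁ᵀ * ω.Ω₁ S.h + S.A₀ᵀ * ω.Ω₂ S.h + S.Bdᵀ * ω.Ω₅ S.h
  boundary₁₂ : ω.Ω₁ 0 - ω.Ω₂ S.h = 0
  boundary₃ : ω.Ω₃ 0 = 0
  boundary₄ : ω.Ω₄ S.h = 0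
  boundary₅ : ω.Ω₅ 0 = 0
  boundary₆ : ω.Ω₆ S.h = 0

/-- The `n_s × n_s` matrix `E` of the vectorized dynamics. -/
def E : Matrix (Fin (auxDim n d)) (Fin (auxDim n d)) ℝ :=
  let I : Matrix (Fin n) (Fin n) ℝ := 1
  Matrix.reindex (stateEquiv n d) (stateEquiv n d) <| rows₆
    (cols₆ (S.A₀ᵀ ⊗ₖ I) (S.A₁ᵀ ⊗ₖ I) (S.Bdᵀ ⊗ₖ I) (S.Bdᵀ ⊗ₖ I) 0 0)
    (cols₆ (-(I ⊗ₖ S.A₁ᵀ)) (-(I ⊗ₖ S.A₀ᵀ)) 0 0 (-(I ⊗ₖ S.Bdᵀ)) (-(I ⊗ₖ S.Bdᵀ)))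
    (cols₆ (S.Cdᵀ ⊗ₖ I) 0 (-(S.Adᵀ ⊗ₖ I)) 0 0 0)
    (cols₆ 0 (-(S.CdExpᵀ ⊗ₖ I)) 0 (-(S.Adᵀ ⊗ₖ I)) 0 0)
    (cols₆ (I ⊗ₖ S.CdExpᵀ) 0 0 0 (I ⊗ₖ S.Adᵀ) 0)
    (cols₆ 0 (-(I ⊗ₖ S.Cdᵀ)) 0 0 0 (I ⊗ₖ S.Adᵀ))

/-- The `n_s × n_s` matrix `F₁`, the coefficient of the stacked state at time `0` in the
vectorized boundary conditions. -/
def F₁ : Matrix (Fin (auxDim n d)) (Fin (auxDim n d)) ℝ :=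
  let I : Matrix (Fin n) (Fin n) ℝ := 1
  let J : Matrix (Fin d) (Fin d) ℝ := 1
  Matrix.reindex (rowEquiv n d) (stateEquiv n d) <| rows₆
    (cols₆ (S.A₀ᵀ ⊗ₖ I) (S.A₁ᵀ ⊗ₖ I) (S.Bdᵀ ⊗ₖ I) (S.Bdᵀ ⊗ₖ I) 0 0)
    (cols₆ (I ⊗ₖ I) 0 0 0 0 0)
    (cols₆ 0 0 (J ⊗ₖ I) 0 0 0)
    (cols₆ 0 0 0 0 (I ⊗ₖ J) 0)
    (cols₆ 0 0 0 0 0 0)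
    (cols₆ 0 0 0 0 0 0)

/-- The `n_s × n_s` matrix `F₂`, the coefficient of the stacked state at time `h` in the
vectorized boundary conditions. -/
def F₂ : Matrix (Fin (auxDim n d)) (Fin (auxDim n d)) ℝ :=
  let I : Matrix (Fin n) (Fin n) ℝ := 1
  let J : Matrix (Fin d) (Fin d) ℝ := 1
  Matrix.reindex (rowEquiv n d) (stateEquiv n d) <| rows₆
    (cols₆ (I ⊗ₖ S.A₁ᵀ) (I ⊗ₖ S.A₀ᵀ) 0 0 (I ⊗ₖ S.Bdᵀ) (I ⊗ₖ S.Bdᵀ))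
    (cols₆ 0 (-(I ⊗ₖ I)) 0 0 0 0)
    (cols₆ 0 0 0 0 0 0)
    (cols₆ 0 0 0 0 0 0)
    (cols₆ 0 0 0 (J ⊗ₖ I) 0 0)
    (cols₆ 0 0 0 0 0 (I ⊗ₖ J))

/-- The flow `e^{E τ}`. -/
def flow (τ : ℝ) : Matrix (Fin (auxDim n d)) (Fin (auxDim n d)) ℝ :=
  NormedSpace.exp (τ • S.E)

end DelaySystem

end

/-!
The auxiliary system is a delay-free form of a pair of delay equations. Write `Y` for the function
on `[-h, h]` that is `Ω₁` on `[0, h]` and `Ω₂(· + h)` on `[-h, 0]`, write `L` for the right-hand side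
of the matrix delay equation (`delayOp`), and `Y♯(t) = Y(-t)ᵀ` for the time reversal. On `[0, h]` the
components `Ω₃, …, Ω₆` of a solution are determined by `Y` (`SolvesBoundary.stacked_eq`), and the
system says that both `Y` and `Y♯` solve `Y' = L Y` on `[0, h]`, the algebraic condition being that
`Y'` has the jump `-Q` at `0`. This dictionary works in both directions
(`bdryMatrix_mulVec_auxOf`).

The first claim is the vectorization of the system together with the uniqueness of solutions of
linear differential equations.

For the second claim, let `λ` and `-λ` be in the spectrum, with left null vectors `w` and `u` of the
characteristic matrices. Then `e^{λ t} u wᵀ` and its time reversal solve the delay equation, which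
gives a nonzero element in the kernel of the boundary matrix (`spectrumCondition_of_isUnit`).
Conversely, the homogeneous solutions are closed under the differentiation `Y ↦ Y'`
(`isODEcSolution_auxDerivative`). The only condition that is not immediate is that `Y''` has no jump
at `0`; since `Y' = L Y` to the right of `0` and `Y' = -(L Y♯)♯` to the left, this says that `L`
commutes with its conjugate by time reversal, which holds because one acts from the right and the
other from the left, by Fubini's theorem (`delayOp_advanceOp_comm`). If the kernel of the boundary
matrix is nonzero, differentiation therefore has a complex eigenvector in it, that is, a solution
`e^{λ t} M` with `M ≠ 0`. The delay equations for it and for its time reversal are `M Δ(λ) = 0` and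
`Mᵀ Δ(-λ) = 0`, where `Δ` is the characteristic matrix, so `λ` and `-λ` are in the spectrum
(`isUnit_of_spectrumCondition`).

For the third claim, time reversal turns solutions of the boundary value problem for `Q` into
solutions for `Qᵀ`. By uniqueness the solution for a symmetric `Q` is fixed by it, so that `Y = Y♯`
solves the delay equation with coupling conditions (`isDDEcSolution_gluing`); every other solution
of that equation gives a solution of the boundary value problem (`IsDDEcSolution.exists_stacked`),
and so coincides with `Y`.
-/

noncomputable section

/-! ### Entrywise calculus of matrix-valued functions -/

section MatrixCalculus

variable {p q r : ℕ}

namespace MatHasDerivAt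

variable {f g : ℝ → Matrix (Fin p) (Fin q) ℝ} {f' g' : Matrix (Fin p) (Fin q) ℝ} {τ : ℝ}

theorem add (hf : MatHasDerivAt f f' τ) (hg : MatHasDerivAt g g' τ) :
    MatHasDerivAt (fun t => f t + g t) (f' + g') τ := fun i j => (hf i j).add (hg i j)

theorem sub (hf : MatHasDerivAt f f' τ) (hg : MatHasDerivAt g g' τ) :
    MatHasDerivAt (fun t => f t - g t) (f' - g') τ := fun i j => (hf i j).sub (hg i j)

theorem neg (hf : MatHasDerivAt f f' τ) : MatHasDerivAt (fun t => -f t) (-f') τ :=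
  fun i j => (hf i j).neg

theorem transpose (hf : MatHasDerivAt f f' τ) : MatHasDerivAt (fun t => (f t)ᵀ) f'ᵀ τ :=
  fun i j => hf j i

theorem const_mul (A : Matrix (Fin r) (Fin p) ℝ) (hf : MatHasDerivAt f f' τ) :
    MatHasDerivAt (fun t => A * f t) (A * f') τ := fun i j => by
  simpa only [Matrix.mul_apply] using
    HasDerivAt.fun_sum fun k (_ : k ∈ Finset.univ) => (hf k j).const_mul (A i k)

theorem mul {k : ℝ → Matrix (Fin q) (Fin r) ℝ} {k' : Matrix (Fin q) (Fin r) ℝ}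
    (hf : MatHasDerivAt f f' τ) (hk : MatHasDerivAt k k' τ) :
    MatHasDerivAt (fun t => f t * k t) (f' * k τ + f τ * k') τ := fun i j => by
  simpa only [Matrix.mul_apply, Matrix.add_apply, ← Finset.sum_add_distrib] using
    HasDerivAt.fun_sum fun l (_ : l ∈ Finset.univ) => (hf i l).fun_mul (hk l j)

theorem mul_const (hf : MatHasDerivAt f f' τ) (A : Matrix (Fin q) (Fin r) ℝ) :
    MatHasDerivAt (fun t => f t * A) (f' * A) τ := fun i j => by
  simpa only [Matrix.mul_apply] using
    HasDerivAt.fun_sum fun k (_ : k ∈ Finset.univ) => (hf i k).mul_const (A k j)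

theorem reflect {c : ℝ} (hf : MatHasDerivAt f f' (c - τ)) :
    MatHasDerivAt (fun t => f (c - t)) (-f') τ := fun i j => by
  simpa using HasDerivAt.comp_const_sub c τ (hf i j)

theorem congr_deriv (hf : MatHasDerivAt f f' τ) (h : f' = g') : MatHasDerivAt f g' τ := h ▸ hf

theorem continuous {F : ℝ → Matrix (Fin p) (Fin q) ℝ} (hf : ∀ τ, MatHasDerivAt f (F τ) τ) :
    Continuous f :=
  continuous_matrix fun i j => continuous_iff_continuousAt.2 fun τ => (hf τ i j).continuousAt

end MatHasDerivAt

theorem matHasDerivWithinAt_univ {f : ℝ → Matrix (Fin p) (Fin q) ℝ}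
    {f' : Matrix (Fin p) (Fin q) ℝ} {τ : ℝ} :
    MatHasDerivWithinAt f f' Set.univ τ ↔ MatHasDerivAt f f' τ := by
  simp only [MatHasDerivWithinAt, MatHasDerivAt, hasDerivWithinAt_univ]

theorem MatHasDerivAt.within {f : ℝ → Matrix (Fin p) (Fin q) ℝ}
    {f' : Matrix (Fin p) (Fin q) ℝ} {τ : ℝ} (h : MatHasDerivAt f f' τ) (s : Set ℝ) :
    MatHasDerivWithinAt f f' s τ := fun i j => (h i j).hasDerivWithinAt

/-- A matrix-valued function whose derivative vanishes is constant on convex sets. -/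
theorem matrix_eq_of_deriv_eq_zero {f : ℝ → Matrix (Fin p) (Fin q) ℝ} {s : Set ℝ}
    (hs : Convex ℝ s) (hf : ∀ τ ∈ s, MatHasDerivWithinAt f 0 s τ) {a b : ℝ} (ha : a ∈ s)
    (hb : b ∈ s) : f b = f a := by
  ext i j
  have := hs.norm_image_sub_le_of_norm_hasDerivWithin_le (C := 0)
    (fun x hx => hf x hx i j) (by simp) ha hb
  simpa [sub_eq_zero] using this

section Exp

variable {m : Type} [Fintype m] [DecidableEq m] (A : Matrix m m ℝ)

theorem hasDerivAt_exp_smul_apply (t : ℝ) (i j : m) :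
    HasDerivAt (fun s : ℝ => NormedSpace.exp (s • A) i j)
      ((A * NormedSpace.exp (t • A)) i j) t := by
  let _ : NormedRing (Matrix m m ℝ) := Matrix.linftyOpNormedRing
  let _ : NormedAlgebra ℝ (Matrix m m ℝ) := Matrix.linftyOpNormedAlgebra
  have h := hasDerivAt_exp_smul_const' (𝕂 := ℝ) A t
  exact (hasDerivAt_pi.1 ((hasDerivAt_pi (𝕜 := ℝ)).1 h i) j)

theorem exp_smul_mul_self_comm (t : ℝ) :
    NormedSpace.exp (t • A) * A = A * NormedSpace.exp (t • A) :=
  (((Commute.refl A).smul_left t).exp_left).eq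

theorem exp_add_smul (s t : ℝ) :
    NormedSpace.exp ((s + t) • A) = NormedSpace.exp (s • A) * NormedSpace.exp (t • A) := by
  rw [add_smul]
  exact Matrix.exp_add_of_commute _ _ (((Commute.refl A).smul_left s).smul_right t)

theorem continuous_exp_smul : Continuous fun t : ℝ => NormedSpace.exp (t • A) :=
  continuous_matrix fun i j => continuous_iff_continuousAt.2 fun t =>
    (hasDerivAt_exp_smul_apply A t i j).continuousAt

end Exp

theorem matHasDerivAt_exp_smul (A : Matrix (Fin p) (Fin p) ℝ) (t : ℝ) :
    MatHasDerivAt (fun s => NormedSpace.exp (s • A)) (A * NormedSpace.exp (t • A)) t :=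
  fun i j => hasDerivAt_exp_smul_apply A t i j

theorem matHasDerivAt_exp_neg_smul (A : Matrix (Fin p) (Fin p) ℝ) (t : ℝ) :
    MatHasDerivAt (fun s => NormedSpace.exp ((-s) • A))
      (-(NormedSpace.exp ((-t) • A) * A)) t := fun i j => by
  have := (hasDerivAt_exp_smul_apply A (-t) i j).scomp t (hasDerivAt_neg t)
  rw [exp_smul_mul_self_comm]
  simpa [Function.comp_def] using this

/-! ### Entrywise integrals of matrix-valued functions -/

section MatIntegral

variable {f g : ℝ → Matrix (Fin p) (Fin q) ℝ} {a b c : ℝ}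

theorem intervalIntegrable_entry (hf : Continuous f) (i : Fin p) (j : Fin q) :
    IntervalIntegrable (fun t => f t i j) MeasureTheory.volume a b :=
  (hf.matrix_elem i j).intervalIntegrable a b

theorem matIntegral_add (hf : Continuous f) (hg : Continuous g) :
    matIntegral (fun t => f t + g t) a b = matIntegral f a b + matIntegral g a b := by
  ext i j
  exact intervalIntegral.integral_add (intervalIntegrable_entry hf i j)
    (intervalIntegrable_entry hg i j)

theorem matIntegral_const_mul (A : Matrix (Fin r) (Fin p) ℝ) (hf : Continuous f) :
    matIntegral (fun t => A * f t) a b = A * matIntegral f a b := by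
  ext i j
  simp only [matIntegral, Matrix.mul_apply, Matrix.of_apply]
  rw [intervalIntegral.integral_finsetSum
    fun k _ => (intervalIntegrable_entry hf k j).const_mul (A i k)]
  simp

theorem matIntegral_mul_const (hf : Continuous f) (A : Matrix (Fin q) (Fin r) ℝ) :
    matIntegral (fun t => f t * A) a b = matIntegral f a b * A := by
  ext i j
  simp only [matIntegral, Matrix.mul_apply, Matrix.of_apply]
  rw [intervalIntegral.integral_finsetSum
    fun k _ => (intervalIntegrable_entry hf i k).mul_const (A k j)]
  simp

theorem matIntegral_transpose : (matIntegral f a b)ᵀ = matIntegral (fun t => (f t)ᵀ) a b := rfl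

theorem matIntegral_congr (h : ∀ t ∈ Set.uIcc a b, f t = g t) :
    matIntegral f a b = matIntegral g a b := by
  ext i j
  exact intervalIntegral.integral_congr fun t ht => by rw [h t ht]

theorem matIntegral_self : matIntegral f a a = 0 := by
  ext i j
  exact intervalIntegral.integral_same

theorem matIntegral_add_adjacent (hf : Continuous f) :
    matIntegral f a b + matIntegral f b c = matIntegral f a c := by
  ext i j
  exact intervalIntegral.integral_add_adjacent_intervals (intervalIntegrable_entry hf i j)
    (intervalIntegrable_entry hf i j)

theorem matIntegral_comp_add_left (d : ℝ) :
    matIntegral (fun t => f (d + t)) a b = matIntegral f (d + a) (d + b) := by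
  ext i j
  exact intervalIntegral.integral_comp_add_left (fun t => f t i j) d

theorem matHasDerivAt_matIntegral (hf : Continuous f) (a t : ℝ) :
    MatHasDerivAt (fun s => matIntegral f a s) (f t) t := fun i j =>
  intervalIntegral.integral_hasDerivAt_right (intervalIntegrable_entry hf i j)
    (hf.matrix_elem i j).aestronglyMeasurable.stronglyMeasurableAtFilter
    (hf.matrix_elem i j).continuousAt

/-- The order of integration over a rectangle is immaterial. -/
theorem matIntegral_swap {F : ℝ → ℝ → Matrix (Fin p) (Fin q) ℝ}
    (hF : Continuous (Function.uncurry F)) (a b c d : ℝ) :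
    matIntegral (fun s => matIntegral (fun t => F s t) c d) a b =
      matIntegral (fun t => matIntegral (fun s => F s t) a b) c d := by
  ext i j
  have hc : Continuous (Function.uncurry fun s t => F s t i j) := hF.matrix_elem i j
  exact MeasureTheory.intervalIntegral_intervalIntegral_swap
    ((hc.continuousOn.integrableOn_compact
      (isCompact_uIcc.prod isCompact_uIcc)).mono_set
        (Set.prod_mono Set.uIoc_subset_uIcc Set.uIoc_subset_uIcc))

theorem continuous_matIntegral {F : ℝ → ℝ → Matrix (Fin p) (Fin q) ℝ}
    (hF : Continuous (Function.uncurry F)) (a b : ℝ) :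
    Continuous fun s => matIntegral (F s) a b :=
  continuous_matrix fun i j =>
    intervalIntegral.continuous_parametric_intervalIntegral_of_continuous'
      (f := fun s t => F s t i j) (hF.matrix_elem i j) a b

end MatIntegral

end MatrixCalculus

/-! ### Linear differential equations with constant coefficients -/

section LinearODE

variable {m : Type} [Fintype m] [DecidableEq m] (A : Matrix m m ℝ)

theorem hasDerivAt_exp_smul_mulVec (v : m → ℝ) (t : ℝ) :
    HasDerivAt (fun s : ℝ => NormedSpace.exp (s • A) *ᵥ v)
      (A *ᵥ (NormedSpace.exp (t • A) *ᵥ v)) t := by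
  rw [hasDerivAt_pi]
  intro i
  rw [Matrix.mulVec_mulVec]
  simpa only [Matrix.mulVec, dotProduct] using
    HasDerivAt.fun_sum fun k (_ : k ∈ Finset.univ) =>
      (hasDerivAt_exp_smul_apply A t i k).mul_const (v k)

/-- Solutions of `w' = A w` on a convex set of times containing `0` are given by the exponential
of `A`. -/
theorem eq_exp_smul_mulVec {s : Set ℝ} (hs : Convex ℝ s) (h0 : (0 : ℝ) ∈ s) {w : ℝ → m → ℝ}
    (hw : ∀ τ ∈ s, HasDerivWithinAt w (A *ᵥ w τ) s τ) {τ : ℝ} (hτ : τ ∈ s) :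
    w τ = NormedSpace.exp (τ • A) *ᵥ w 0 := by
  have hz : ∀ t ∈ s, HasDerivWithinAt (fun t => NormedSpace.exp ((-t) • A) *ᵥ w t) 0 s t := by
    intro t ht
    rw [hasDerivWithinAt_pi]
    intro i
    have hE : ∀ k, HasDerivAt (fun s : ℝ => NormedSpace.exp ((-s) • A) i k)
        (-(NormedSpace.exp ((-t) • A) * A) i k) t := fun k => by
      have := (hasDerivAt_exp_smul_apply A (-t) i k).scomp t (hasDerivAt_neg t)
      rw [exp_smul_mul_self_comm]
      simpa [Function.comp_def] using this
    have := HasDerivWithinAt.fun_sum fun k (_ : k ∈ Finset.univ) =>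
      (hE k).hasDerivWithinAt.fun_mul (hasDerivWithinAt_pi.1 (hw t ht) k)
    simp only [Matrix.mulVec, dotProduct] at this ⊢
    convert this using 1
    rw [Finset.sum_add_distrib]
    have h2 : ∑ k, NormedSpace.exp ((-t) • A) i k * ∑ l, A k l * w t l =
        ∑ k, (NormedSpace.exp ((-t) • A) * A) i k * w t k := by
      have := congrFun (Matrix.mulVec_mulVec (w t) (NormedSpace.exp ((-t) • A)) A) i
      simpa only [Matrix.mulVec, dotProduct] using this
    rw [h2]
    simp
  have hc : NormedSpace.exp ((-τ) • A) *ᵥ w τ = NormedSpace.exp ((-0 : ℝ) • A) *ᵥ w 0 := by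
    have := hs.norm_image_sub_le_of_norm_hasDerivWithin_le (C := 0) hz (by simp) h0 hτ
    simpa [sub_eq_zero] using this
  have h1 := congrArg (NormedSpace.exp (τ • A) *ᵥ ·) hc
  simpa only [Matrix.mulVec_mulVec, ← exp_add_smul, add_neg_cancel, neg_zero, zero_smul,
    NormedSpace.exp_zero, Matrix.one_mulVec, Matrix.mul_one] using h1

end LinearODE

/-! ### Vectorization of the auxiliary system -/

namespace AuxTrajectory

variable {n d : ℕ}

theorem stacked_eq_iff {ω η : AuxTrajectory n d} {s t : ℝ} :
    ω.stacked s = η.stacked t ↔ ω.Ω₁ s = η.Ω₁ t ∧ ω.Ω₂ s = η.Ω₂ t ∧ ω.Ω₃ s = η.Ω₃ t ∧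
      ω.Ω₄ s = η.Ω₄ t ∧ ω.Ω₅ s = η.Ω₅ t ∧ ω.Ω₆ s = η.Ω₆ t := by
  rw [stacked, stacked, (Equiv.surjective _).injective_comp_right.eq_iff]
  simp only [stack₆, Sum.elim_eq_iff, Matrix.vec_inj]

/-- The trajectory with a given stacked state at every time. -/
def ofStacked (w : ℝ → Fin (auxDim n d) → ℝ) : AuxTrajectory n d where
  Ω₁ τ := Matrix.of fun i j => w τ (stateEquiv n d (.inl (j, i)))
  Ω₂ τ := Matrix.of fun i j => w τ (stateEquiv n d (.inr (.inl (j, i))))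
  Ω₃ τ := Matrix.of fun i j => w τ (stateEquiv n d (.inr (.inr (.inl (j, i)))))
  Ω₄ τ := Matrix.of fun i j => w τ (stateEquiv n d (.inr (.inr (.inr (.inl (j, i))))))
  Ω₅ τ := Matrix.of fun i j => w τ (stateEquiv n d (.inr (.inr (.inr (.inr (.inl (j, i)))))))
  Ω₆ τ := Matrix.of fun i j => w τ (stateEquiv n d (.inr (.inr (.inr (.inr (.inr (j, i)))))))

theorem stacked_ofStacked (w : ℝ → Fin (auxDim n d) → ℝ) (τ : ℝ) :
    (ofStacked w).stacked τ = w τ := by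
  rw [stacked]
  refine (Equiv.comp_symm_eq _ _ _).2 (funext ?_)
  rintro (x | x | x | x | x | x) <;> rfl

theorem hasDerivWithinAt_stacked_iff {ω η : AuxTrajectory n d} {s : Set ℝ} {τ : ℝ} :
    HasDerivWithinAt ω.stacked (η.stacked τ) s τ ↔
      MatHasDerivWithinAt ω.Ω₁ (η.Ω₁ τ) s τ ∧ MatHasDerivWithinAt ω.Ω₂ (η.Ω₂ τ) s τ ∧
      MatHasDerivWithinAt ω.Ω₃ (η.Ω₃ τ) s τ ∧ MatHasDerivWithinAt ω.Ω₄ (η.Ω₄ τ) s τ ∧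
      MatHasDerivWithinAt ω.Ω₅ (η.Ω₅ τ) s τ ∧ MatHasDerivWithinAt ω.Ω₆ (η.Ω₆ τ) s τ := by
  rw [hasDerivWithinAt_pi, (stateEquiv n d).symm.forall_congr_left]
  simp only [stacked, Function.comp_apply, Equiv.symm_symm, Equiv.symm_apply_apply, Sum.forall,
    stack₆, Sum.elim_inl, Sum.elim_inr, Prod.forall, MatHasDerivWithinAt]
  simp only [Matrix.vec]
  constructor
  · rintro ⟨h1, h2, h3, h4, h5, h6⟩
    exact ⟨fun i j => h1 j i, fun i j => h2 j i, fun i j => h3 j i, fun i j => h4 j i,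
      fun i j => h5 j i, fun i j => h6 j i⟩
  · rintro ⟨h1, h2, h3, h4, h5, h6⟩
    exact ⟨fun i j => h1 j i, fun i j => h2 j i, fun i j => h3 j i, fun i j => h4 j i,
      fun i j => h5 j i, fun i j => h6 j i⟩

end AuxTrajectory

section Blocks

variable {κ α₁ α₂ α₃ α₄ α₅ α₆ : Type}

theorem rows₆_mulVec [Fintype κ] (M₁ : Matrix α₁ κ ℝ) (M₂ : Matrix α₂ κ ℝ) (M₃ : Matrix α₃ κ ℝ)
    (M₄ : Matrix α₄ κ ℝ) (M₅ : Matrix α₅ κ ℝ) (M₆ : Matrix α₆ κ ℝ) (v : κ → ℝ) :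
    rows₆ M₁ M₂ M₃ M₄ M₅ M₆ *ᵥ v =
      stack₆ (M₁ *ᵥ v) (M₂ *ᵥ v) (M₃ *ᵥ v) (M₄ *ᵥ v) (M₅ *ᵥ v) (M₆ *ᵥ v) := by
  simp only [rows₆, stack₆, Matrix.fromRows_mulVec]

theorem cols₆_mulVec [Fintype α₁] [Fintype α₂] [Fintype α₃] [Fintype α₄] [Fintype α₅]
    [Fintype α₆] (M₁ : Matrix κ α₁ ℝ) (M₂ : Matrix κ α₂ ℝ) (M₃ : Matrix κ α₃ ℝ)
    (M₄ : Matrix κ α₄ ℝ) (M₅ : Matrix κ α₅ ℝ) (M₆ : Matrix κ α₆ ℝ) (v₁ : α₁ → ℝ) (v₂ : α₂ → ℝ)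
    (v₃ : α₃ → ℝ) (v₄ : α₄ → ℝ) (v₅ : α₅ → ℝ) (v₆ : α₆ → ℝ) :
    cols₆ M₁ M₂ M₃ M₄ M₅ M₆ *ᵥ stack₆ v₁ v₂ v₃ v₄ v₅ v₆ =
      M₁ *ᵥ v₁ + (M₂ *ᵥ v₂ + (M₃ *ᵥ v₃ + (M₄ *ᵥ v₄ + (M₅ *ᵥ v₅ + M₆ *ᵥ v₆)))) := by
  simp only [cols₆, stack₆, Matrix.fromCols_mulVec_sumElim]

theorem stack₆_add (u₁ v₁ : α₁ → ℝ) (u₂ v₂ : α₂ → ℝ) (u₃ v₃ : α₃ → ℝ) (u₄ v₄ : α₄ → ℝ)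
    (u₅ v₅ : α₅ → ℝ) (u₆ v₆ : α₆ → ℝ) :
    stack₆ u₁ u₂ u₃ u₄ u₅ u₆ + stack₆ v₁ v₂ v₃ v₄ v₅ v₆ =
      stack₆ (u₁ + v₁) (u₂ + v₂) (u₃ + v₃) (u₄ + v₄) (u₅ + v₅) (u₆ + v₆) := by
  simp only [stack₆, Sum.elim_add_add]

theorem reindex_mulVec_comp_symm {β γ δ : Type} [Fintype β] [Fintype δ]
    (e : α₁ ≃ γ) (f : β ≃ δ) (M : Matrix α₁ β ℝ) (v : β → ℝ) :
    Matrix.reindex e f M *ᵥ (v ∘ f.symm) = (M *ᵥ v) ∘ e.symm := by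
  rw [Matrix.reindex_apply, Matrix.submatrix_mulVec_equiv]
  congr 2
  ext x
  simp

end Blocks

namespace DelaySystem

variable {n d : ℕ} (S : DelaySystem n d)

/-- The right-hand sides of the six differential equations along a trajectory. -/
def auxField (ω : AuxTrajectory n d) : AuxTrajectory n d where
  Ω₁ τ := ω.Ω₁ τ * S.A₀ + ω.Ω₂ τ * S.A₁ + ω.Ω₃ τ * S.Bd + ω.Ω₄ τ * S.Bd
  Ω₂ τ := -(S.A₁ᵀ * ω.Ω₁ τ) - S.A₀ᵀ * ω.Ω₂ τ - S.Bdᵀ * ω.Ω₅ τ - S.Bdᵀ * ω.Ω₆ τ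
  Ω₃ τ := -(ω.Ω₃ τ * S.Ad) + ω.Ω₁ τ * S.Cd
  Ω₄ τ := -(ω.Ω₄ τ * S.Ad) - ω.Ω₂ τ * S.CdExp
  Ω₅ τ := S.Adᵀ * ω.Ω₅ τ + S.CdExpᵀ * ω.Ω₁ τ
  Ω₆ τ := S.Adᵀ * ω.Ω₆ τ - S.Cdᵀ * ω.Ω₂ τ

theorem E_mulVec_stacked (ω : AuxTrajectory n d) (τ : ℝ) :
    S.E *ᵥ ω.stacked τ = (S.auxField ω).stacked τ := by
  rw [AuxTrajectory.stacked, AuxTrajectory.stacked, E, reindex_mulVec_comp_symm, rows₆_mulVec]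
  simp only [cols₆_mulVec, Matrix.neg_mulVec, Matrix.zero_mulVec, Matrix.kronecker_mulVec_vec,
    Matrix.transpose_transpose, Matrix.transpose_one, Matrix.one_mul, Matrix.mul_one]
  simp only [auxField, Matrix.vec_add, Matrix.vec_sub, Matrix.vec_neg]
  congr 2 <;> abel

/-- The boundary conditions at `0` and `h` of the auxiliary system, apart from the algebraic one. -/
structure BoundaryConditions (ω : AuxTrajectory n d) : Prop where
  boundary₁₂ : ω.Ω₁ 0 = ω.Ω₂ S.h
  boundary₃ : ω.Ω₃ 0 = 0
  boundary₄ : ω.Ω₄ S.h = 0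
  boundary₅ : ω.Ω₅ 0 = 0
  boundary₆ : ω.Ω₆ S.h = 0

/-- For trajectories satisfying the other boundary conditions, the algebraic condition says that
`Ω₁'(0) - Ω₂'(h) = -Q`. -/
theorem algebraic_iff {S : DelaySystem n d} {ω : AuxTrajectory n d} (hω : S.BoundaryConditions ω)
    (Q : Matrix (Fin n) (Fin n) ℝ) :
    -Q = ω.Ω₁ 0 * S.A₀ + ω.Ω₂ 0 * S.A₁ + ω.Ω₄ 0 * S.Bd
      + S.A₁ᵀ * ω.Ω₁ S.h + S.A₀ᵀ * ω.Ω₂ S.h + S.Bdᵀ * ω.Ω₅ S.h ↔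
    (S.auxField ω).Ω₁ 0 - (S.auxField ω).Ω₂ S.h = -Q := by
  simp only [auxField, hω.boundary₃, hω.boundary₆, Matrix.zero_mul, Matrix.mul_zero]
  rw [eq_comm]
  apply Eq.congr_left
  abel

theorem boundary_mulVec_iff (ω : AuxTrajectory n d) (Q : Matrix (Fin n) (Fin n) ℝ) :
    S.F₁ *ᵥ ω.stacked 0 + S.F₂ *ᵥ ω.stacked S.h = boundaryRhs d Q ↔
      S.BoundaryConditions ω ∧ (S.auxField ω).Ω₁ 0 - (S.auxField ω).Ω₂ S.h = -Q := by
  have key : S.F₁ *ᵥ ω.stacked 0 + S.F₂ *ᵥ ω.stacked S.h =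
      stack₆ ((S.auxField ω).Ω₁ 0 - (S.auxField ω).Ω₂ S.h).vec (ω.Ω₁ 0 - ω.Ω₂ S.h).vec
        (ω.Ω₃ 0).vec (ω.Ω₅ 0).vec (ω.Ω₄ S.h).vec (ω.Ω₆ S.h).vec ∘ (rowEquiv n d).symm := by
    rw [AuxTrajectory.stacked, AuxTrajectory.stacked, F₁, F₂, reindex_mulVec_comp_symm,
      reindex_mulVec_comp_symm, rows₆_mulVec, rows₆_mulVec, ← Pi.add_comp, stack₆_add]
    simp only [cols₆_mulVec, Matrix.neg_mulVec, Matrix.zero_mulVec, Matrix.kronecker_mulVec_vec,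
      Matrix.transpose_transpose, Matrix.transpose_one, Matrix.one_mul, Matrix.mul_one,
      auxField, Matrix.vec_add, Matrix.vec_sub, Matrix.vec_neg, add_zero, zero_add]
    congr 2
    abel
  rw [key, boundaryRhs, (Equiv.surjective _).injective_comp_right.eq_iff]
  simp only [stack₆, Sum.elim_eq_iff, ← Matrix.vec_neg, Matrix.vec_inj, Matrix.vec_eq_zero_iff,
    sub_eq_zero (a := ω.Ω₁ 0)]
  constructor
  · rintro ⟨h1, h2, h3, h4, h5, h6⟩
    exact ⟨⟨h2, h3, h5, h4, h6⟩, h1⟩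
  · rintro ⟨⟨h2, h3, h5, h4, h6⟩, h1⟩
    exact ⟨h1, h2, h3, h4, h5, h6⟩

/-- The coefficient matrix `F₁ + F₂ e^{E h}` of the boundary conditions, as conditions on the
initial state. -/
abbrev bdryMatrix : Matrix (Fin (auxDim n d)) (Fin (auxDim n d)) ℝ :=
  S.F₁ + S.F₂ * S.flow S.h

theorem flow_zero : S.flow 0 = 1 := by simp [flow]

/-- Trajectories that satisfy the differential equations on `[0, h]` and the boundary conditions
have an initial state that solves the linear system. -/
theorem bdryMatrix_mulVec_of_Icc {ω : AuxTrajectory n d} {Q : Matrix (Fin n) (Fin n) ℝ}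
    (hode : ∀ τ ∈ Set.Icc 0 S.h,
      HasDerivWithinAt ω.stacked ((S.auxField ω).stacked τ) (Set.Icc 0 S.h) τ)
    (hb : S.BoundaryConditions ω) (hQ : (S.auxField ω).Ω₁ 0 - (S.auxField ω).Ω₂ S.h = -Q) :
    (∀ τ ∈ Set.Icc 0 S.h, ω.stacked τ = S.flow τ *ᵥ ω.stacked 0) ∧
      S.bdryMatrix *ᵥ ω.stacked 0 = boundaryRhs d Q := by
  have hflow : ∀ τ ∈ Set.Icc 0 S.h, ω.stacked τ = S.flow τ *ᵥ ω.stacked 0 := fun τ hτ =>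
    eq_exp_smul_mulVec S.E (convex_Icc 0 S.h) ⟨le_rfl, S.h_nonneg⟩
      (fun t ht => (S.E_mulVec_stacked ω t).symm ▸ hode t ht) hτ
  refine ⟨hflow, ?_⟩
  rw [Matrix.add_mulVec, ← Matrix.mulVec_mulVec, ← hflow S.h ⟨S.h_nonneg, le_rfl⟩]
  exact (S.boundary_mulVec_iff ω Q).2 ⟨hb, hQ⟩

variable {S} in
theorem isODEcSolution_iff {ω : AuxTrajectory n d} {Q : Matrix (Fin n) (Fin n) ℝ} :
    S.IsODEcSolution Q ω ↔
      (∀ τ, HasDerivAt ω.stacked ((S.auxField ω).stacked τ) τ) ∧ S.BoundaryConditions ω ∧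
        (S.auxField ω).Ω₁ 0 - (S.auxField ω).Ω₂ S.h = -Q := by
  simp only [← hasDerivWithinAt_univ, AuxTrajectory.hasDerivWithinAt_stacked_iff,
    matHasDerivWithinAt_univ]
  constructor
  · intro h
    have hb : S.BoundaryConditions ω :=
      ⟨sub_eq_zero.1 h.boundary₁₂, h.boundary₃, h.boundary₄, h.boundary₅, h.boundary₆⟩
    exact ⟨fun τ => ⟨h.ode₁ τ, h.ode₂ τ, h.ode₃ τ, h.ode₄ τ, h.ode₅ τ, h.ode₆ τ⟩, hb,
      (algebraic_iff hb Q).1 h.algebraic⟩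
  · rintro ⟨h, hb, hQ⟩
    exact ⟨fun τ => (h τ).1, fun τ => (h τ).2.1, fun τ => (h τ).2.2.1, fun τ => (h τ).2.2.2.1,
      fun τ => (h τ).2.2.2.2.1, fun τ => (h τ).2.2.2.2.2, (algebraic_iff hb Q).2 hQ,
      sub_eq_zero.2 hb.boundary₁₂, hb.boundary₃, hb.boundary₄, hb.boundary₅, hb.boundary₆⟩

theorem isODEcSolution_iff_flow (Q : Matrix (Fin n) (Fin n) ℝ) (ω : AuxTrajectory n d) :
    S.IsODEcSolution Q ω ↔ (∀ τ : ℝ, ω.stacked τ = S.flow τ *ᵥ ω.stacked 0) ∧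
      S.bdryMatrix *ᵥ ω.stacked 0 = boundaryRhs d Q := by
  rw [isODEcSolution_iff, ← boundary_mulVec_iff]
  have hode : (∀ τ, HasDerivAt ω.stacked ((S.auxField ω).stacked τ) τ) ↔
      ∀ τ : ℝ, ω.stacked τ = S.flow τ *ᵥ ω.stacked 0 := by
    constructor
    · intro h τ
      exact eq_exp_smul_mulVec S.E convex_univ (Set.mem_univ 0)
        (fun t _ => (S.E_mulVec_stacked ω t).symm ▸ (h t).hasDerivWithinAt) (Set.mem_univ τ)
    · intro h τ
      rw [← E_mulVec_stacked, h τ]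
      exact (hasDerivAt_exp_smul_mulVec S.E _ τ).congr_of_eventuallyEq (.of_forall h)
  rw [hode]
  refine and_congr_right fun h => ?_
  rw [Matrix.add_mulVec, ← Matrix.mulVec_mulVec, ← h S.h]

/-- The trajectory of the auxiliary differential equations with a given initial state. -/
def trajectory (v : Fin (auxDim n d) → ℝ) : AuxTrajectory n d :=
  .ofStacked fun τ => S.flow τ *ᵥ v

theorem stacked_trajectory (v : Fin (auxDim n d) → ℝ) (τ : ℝ) :
    (S.trajectory v).stacked τ = S.flow τ *ᵥ v :=
  AuxTrajectory.stacked_ofStacked _ _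

theorem stacked_trajectory_zero (v : Fin (auxDim n d) → ℝ) :
    (S.trajectory v).stacked 0 = v := by
  rw [stacked_trajectory, flow_zero, Matrix.one_mulVec]

theorem isODEcSolution_trajectory {Q : Matrix (Fin n) (Fin n) ℝ} {v : Fin (auxDim n d) → ℝ}
    (hv : S.bdryMatrix *ᵥ v = boundaryRhs d Q) : S.IsODEcSolution Q (S.trajectory v) := by
  rw [isODEcSolution_iff_flow, stacked_trajectory_zero]
  exact ⟨S.stacked_trajectory v, hv⟩

end DelaySystem

/-! ### The delay operator and time reversal -/

/-- The time reversal `t ↦ Y(-t)ᵀ` of a matrix-valued function. -/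
def timeReversal {n : ℕ} (Y : ℝ → Matrix (Fin n) (Fin n) ℝ) (t : ℝ) : Matrix (Fin n) (Fin n) ℝ :=
  (Y (-t))ᵀ

section TimeReversal

variable {n : ℕ} {Y : ℝ → Matrix (Fin n) (Fin n) ℝ}

theorem timeReversal_timeReversal (Y : ℝ → Matrix (Fin n) (Fin n) ℝ) :
    timeReversal (timeReversal Y) = Y := by
  funext t
  simp [timeReversal]

theorem continuous_timeReversal (hY : Continuous Y) : Continuous (timeReversal Y) :=
  (hY.comp continuous_neg).matrix_transpose

end TimeReversal

namespace DelaySystem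

variable {n d : ℕ} (S : DelaySystem n d)

/-- The right-hand side `Y(t) A₀ + Y(t - h) A₁ + ∫ θ in -h..0, Y(t + θ) A_D(θ)` of the delay
equation for matrices. -/
def delayOp (Y : ℝ → Matrix (Fin n) (Fin n) ℝ) (t : ℝ) : Matrix (Fin n) (Fin n) ℝ :=
  Y t * S.A₀ + Y (t - S.h) * S.A₁ + matIntegral (fun θ => Y (t + θ) * S.AD θ) (-S.h) 0

/-- The conjugate of the delay operator by time reversal; it looks forward in time and multiplies
from the left. -/
def advanceOp (Y : ℝ → Matrix (Fin n) (Fin n) ℝ) : ℝ → Matrix (Fin n) (Fin n) ℝ :=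
  timeReversal (S.delayOp (timeReversal Y))

theorem advanceOp_apply (Y : ℝ → Matrix (Fin n) (Fin n) ℝ) (t : ℝ) :
    S.advanceOp Y t = S.A₀ᵀ * Y t + S.A₁ᵀ * Y (t + S.h) +
      matIntegral (fun θ => (S.AD θ)ᵀ * Y (t - θ)) (-S.h) 0 := by
  have h1 : -(-t - S.h) = t + S.h := by ring
  have h2 : ∀ θ, -(-t + θ) = t - θ := fun θ => by ring
  simp only [advanceOp, timeReversal, delayOp, Matrix.transpose_add, Matrix.transpose_mul,
    matIntegral_transpose, Matrix.transpose_transpose, neg_neg, h1, h2]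

theorem continuous_AD : Continuous S.AD :=
  (continuous_const.matrix_mul (continuous_exp_smul S.Ad)).matrix_mul continuous_const

theorem delayOp_congr {Y Z : ℝ → Matrix (Fin n) (Fin n) ℝ} {t : ℝ}
    (h : ∀ s ∈ Set.Icc (t - S.h) t, Y s = Z s) : S.delayOp Y t = S.delayOp Z t := by
  have hh := S.h_nonneg
  rw [delayOp, delayOp, h t ⟨by linarith, le_rfl⟩, h (t - S.h) ⟨le_rfl, by linarith⟩]
  congr 1
  refine matIntegral_congr fun θ hθ => ?_
  rw [Set.uIcc_of_le (by linarith)] at hθ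
  rw [h (t + θ) ⟨by linarith [hθ.1], by linarith [hθ.2]⟩]

/-- The delay operator commutes with its conjugate by time reversal: one acts by multiplications
from the right, the other by multiplications from the left, and the two integrations may be
interchanged. -/
theorem delayOp_advanceOp_comm {Y : ℝ → Matrix (Fin n) (Fin n) ℝ} (hY : Continuous Y) (t : ℝ) :
    S.delayOp (S.advanceOp Y) t = S.advanceOp (S.delayOp Y) t := by
  have hA := S.continuous_AD
  have hR : ∀ c, Continuous fun θ => Y (c + θ) * S.AD θ := fun c =>
    (hY.comp (continuous_const_add c)).matrix_mul hA
  have hL : ∀ c, Continuous fun θ => (S.AD θ)ᵀ * Y (c - θ) := fun c =>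
    hA.matrix_transpose.matrix_mul (hY.comp (continuous_sub_left c))
  have hF : Continuous (Function.uncurry fun θ φ => (S.AD φ)ᵀ * Y (t + θ - φ) * S.AD θ) :=
    ((hA.comp continuous_snd).matrix_transpose.matrix_mul
        (hY.comp ((continuous_const.add continuous_fst).sub continuous_snd))).matrix_mul
      (hA.comp continuous_fst)
  have hF' : Continuous (Function.uncurry fun φ θ => (S.AD φ)ᵀ * Y (t + θ - φ) * S.AD θ) :=
    ((hA.comp continuous_fst).matrix_transpose.matrix_mul
        (hY.comp ((continuous_const.add continuous_snd).sub continuous_fst))).matrix_mul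
      (hA.comp continuous_snd)
  have e1 : matIntegral (fun θ => S.advanceOp Y (t + θ) * S.AD θ) (-S.h) 0 =
      S.A₀ᵀ * matIntegral (fun θ => Y (t + θ) * S.AD θ) (-S.h) 0 +
      S.A₁ᵀ * matIntegral (fun θ => Y (t + S.h + θ) * S.AD θ) (-S.h) 0 +
      matIntegral (fun θ => matIntegral (fun φ => (S.AD φ)ᵀ * Y (t + θ - φ) * S.AD θ)
        (-S.h) 0) (-S.h) 0 := by
    rw [← matIntegral_const_mul _ (hR _), ← matIntegral_const_mul _ (hR _),
      ← matIntegral_add (continuous_const.matrix_mul (hR _)) (continuous_const.matrix_mul (hR _)),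
      ← matIntegral_add]
    · refine congrArg (matIntegral · (-S.h) 0) (funext fun θ => ?_)
      rw [advanceOp_apply, Matrix.add_mul, Matrix.add_mul, Matrix.mul_assoc, Matrix.mul_assoc,
        ← matIntegral_mul_const (hL _), add_right_comm t]
    · exact (continuous_const.matrix_mul (hR _)).add (continuous_const.matrix_mul (hR _))
    · exact continuous_matIntegral hF _ _
  have e2 : matIntegral (fun φ => (S.AD φ)ᵀ * S.delayOp Y (t - φ)) (-S.h) 0 =
      matIntegral (fun φ => (S.AD φ)ᵀ * Y (t - φ)) (-S.h) 0 * S.A₀ +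
      matIntegral (fun φ => (S.AD φ)ᵀ * Y (t - S.h - φ)) (-S.h) 0 * S.A₁ +
      matIntegral (fun φ => matIntegral (fun θ => (S.AD φ)ᵀ * Y (t + θ - φ) * S.AD θ)
        (-S.h) 0) (-S.h) 0 := by
    rw [← matIntegral_mul_const (hL _), ← matIntegral_mul_const (hL _),
      ← matIntegral_add ((hL _).matrix_mul continuous_const) ((hL _).matrix_mul continuous_const),
      ← matIntegral_add]
    · refine congrArg (matIntegral · (-S.h) 0) (funext fun φ => ?_)
      rw [delayOp, Matrix.mul_add, Matrix.mul_add, ← Matrix.mul_assoc, ← Matrix.mul_assoc,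
        ← matIntegral_const_mul _ (hR _), sub_right_comm]
      refine congrArg _ (congrArg (matIntegral · (-S.h) 0) (funext fun θ => ?_))
      rw [Matrix.mul_assoc, sub_add_eq_add_sub]
    · exact ((hL _).matrix_mul continuous_const).add ((hL _).matrix_mul continuous_const)
    · exact continuous_matIntegral hF' _ _
  rw [delayOp, e1, matIntegral_swap hF, advanceOp_apply, advanceOp_apply, advanceOp_apply, e2,
    delayOp, delayOp, sub_add_cancel, add_sub_cancel_right]
  simp only [Matrix.add_mul, Matrix.mul_add, Matrix.mul_assoc]
  abel

/-! ### The auxiliary trajectory of a solution of the delay equation -/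

/-- The convolution `(∫ u in 0..s, Y(u) C_d e^{A_d u}) e^{-A_d τ}`. -/
def convolution (Y : ℝ → Matrix (Fin n) (Fin n) ℝ) (s τ : ℝ) : Matrix (Fin n) (Fin d) ℝ :=
  matIntegral (fun u => Y u * (S.Cd * NormedSpace.exp (u • S.Ad))) 0 s *
    NormedSpace.exp ((-τ) • S.Ad)

theorem convolution_zero (Y : ℝ → Matrix (Fin n) (Fin n) ℝ) (τ : ℝ) :
    S.convolution Y 0 τ = 0 := by
  rw [convolution, matIntegral_self, Matrix.zero_mul]

theorem continuous_mul_kernel {Y : ℝ → Matrix (Fin n) (Fin n) ℝ} (hY : Continuous Y) :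
    Continuous fun u => Y u * (S.Cd * NormedSpace.exp (u • S.Ad)) :=
  hY.matrix_mul (continuous_const.matrix_mul (continuous_exp_smul S.Ad))

theorem matHasDerivAt_convolution {Y : ℝ → Matrix (Fin n) (Fin n) ℝ} (hY : Continuous Y)
    (c τ : ℝ) :
    MatHasDerivAt (fun t => S.convolution Y (t - c) t)
      (Y (τ - c) * (S.Cd * NormedSpace.exp ((-c) • S.Ad)) - S.convolution Y (τ - c) τ * S.Ad)
      τ := by
  have h1 : MatHasDerivAt
      (fun t => matIntegral (fun u => Y u * (S.Cd * NormedSpace.exp (u • S.Ad))) 0 (t - c))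
      (Y (τ - c) * (S.Cd * NormedSpace.exp ((τ - c) • S.Ad))) τ := fun i j => by
    simpa using (matHasDerivAt_matIntegral (S.continuous_mul_kernel hY) 0 (τ - c)
      i j).comp_sub_const τ c
  refine (h1.mul (matHasDerivAt_exp_neg_smul S.Ad τ)).congr_deriv ?_
  have h2 : (-c) • S.Ad = (τ - c + -τ) • S.Ad := by congr 1; ring
  rw [h2, exp_add_smul, convolution]
  simp only [Matrix.mul_neg, Matrix.mul_assoc, sub_eq_add_neg]

/-- The convolutions over the interval `[τ - h, τ]` make up the distributed delay. -/
theorem convolution_sub_mul {Y : ℝ → Matrix (Fin n) (Fin n) ℝ} (hY : Continuous Y)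
    (τ : ℝ) :
    (S.convolution Y τ τ - S.convolution Y (τ - S.h) τ) * S.Bd =
      matIntegral (fun θ => Y (τ + θ) * S.AD θ) (-S.h) 0 := by
  have hk := S.continuous_mul_kernel hY
  have h1 := matIntegral_comp_add_left
    (f := fun u => Y u * S.AD (u - τ)) (a := -S.h) (b := 0) τ
  simp only [add_sub_cancel_left, add_zero, ← sub_eq_add_neg] at h1
  have h2 : ∀ u, Y u * S.AD (u - τ) = Y u * (S.Cd * NormedSpace.exp (u • S.Ad)) *
      (NormedSpace.exp ((-τ) • S.Ad) * S.Bd) := fun u => by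
    rw [AD, sub_eq_add_neg, exp_add_smul]
    simp only [Matrix.mul_assoc]
  simp only [h2] at h1
  rw [h1, matIntegral_mul_const hk, convolution, convolution, ← Matrix.sub_mul, Matrix.mul_assoc,
    ← matIntegral_add_adjacent hk (a := 0) (b := τ - S.h) (c := τ), add_sub_cancel_left]

/-- The trajectory of the auxiliary system that belongs to a function `Y`: `Ω₁` and `Ω₂` are `Y`
and `Y(· - h)`, and the other four are the parts of the distributed delay terms over `[0, τ]` and
`[τ - h, 0]`. The last two are defined through the time reversal of `Y`, so that statements about
them follow from those about `Ω₄` and `Ω₃`. -/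
def auxOf (Y : ℝ → Matrix (Fin n) (Fin n) ℝ) : AuxTrajectory n d where
  Ω₁ := Y
  Ω₂ τ := Y (τ - S.h)
  Ω₃ τ := S.convolution Y τ τ
  Ω₄ τ := -S.convolution Y (τ - S.h) τ
  Ω₅ τ := (-S.convolution (timeReversal Y) (S.h - τ - S.h) (S.h - τ))ᵀ
  Ω₆ τ := (S.convolution (timeReversal Y) (S.h - τ) (S.h - τ))ᵀ

/-- The time reversal of a trajectory of the auxiliary system. It interchanges the components in
pairs and turns solutions for `Q` into solutions for `Qᵀ`. -/
def auxReversal (ω : AuxTrajectory n d) : AuxTrajectory n d where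
  Ω₁ τ := (ω.Ω₂ (S.h - τ))ᵀ
  Ω₂ τ := (ω.Ω₁ (S.h - τ))ᵀ
  Ω₃ τ := (ω.Ω₆ (S.h - τ))ᵀ
  Ω₄ τ := (ω.Ω₅ (S.h - τ))ᵀ
  Ω₅ τ := (ω.Ω₄ (S.h - τ))ᵀ
  Ω₆ τ := (ω.Ω₃ (S.h - τ))ᵀ

theorem auxReversal_auxOf (Y : ℝ → Matrix (Fin n) (Fin n) ℝ) :
    S.auxReversal (S.auxOf Y) = S.auxOf (timeReversal Y) := by
  simp only [auxReversal, auxOf, timeReversal_timeReversal, AuxTrajectory.mk.injEq,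
    sub_sub_cancel, Matrix.transpose_transpose, and_true]
  constructor <;> funext τ <;> simp [timeReversal]

theorem auxField_auxReversal (ω : AuxTrajectory n d) :
    S.auxField (S.auxReversal ω) = ⟨fun τ => -(S.auxReversal (S.auxField ω)).Ω₁ τ,
      fun τ => -(S.auxReversal (S.auxField ω)).Ω₂ τ,
      fun τ => -(S.auxReversal (S.auxField ω)).Ω₃ τ,
      fun τ => -(S.auxReversal (S.auxField ω)).Ω₄ τ,
      fun τ => -(S.auxReversal (S.auxField ω)).Ω₅ τ,
      fun τ => -(S.auxReversal (S.auxField ω)).Ω₆ τ⟩ := by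
  simp only [auxField, auxReversal, AuxTrajectory.mk.injEq]
  refine ⟨?_, ?_, ?_, ?_, ?_, ?_⟩ <;> funext τ <;>
    simp only [Matrix.transpose_add, Matrix.transpose_sub, Matrix.transpose_neg,
      Matrix.transpose_mul, Matrix.transpose_transpose] <;> abel

theorem auxField_auxOf_Ω₁ {Y : ℝ → Matrix (Fin n) (Fin n) ℝ} (hY : Continuous Y) (τ : ℝ) :
    (S.auxField (S.auxOf Y)).Ω₁ τ = S.delayOp Y τ := by
  rw [delayOp, ← S.convolution_sub_mul hY]
  simp only [auxField, auxOf, Matrix.sub_mul, Matrix.neg_mul]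
  abel

theorem auxField_auxOf_Ω₂ {Y : ℝ → Matrix (Fin n) (Fin n) ℝ} (hY : Continuous Y) (τ : ℝ) :
    (S.auxField (S.auxOf Y)).Ω₂ τ = -(S.delayOp (timeReversal Y) (S.h - τ))ᵀ := by
  rw [← S.auxField_auxOf_Ω₁ (continuous_timeReversal hY), ← auxReversal_auxOf,
    auxField_auxReversal]
  simp [auxReversal]

theorem matHasDerivAt_auxOf_Ω₃ {Y : ℝ → Matrix (Fin n) (Fin n) ℝ} (hY : Continuous Y) (τ : ℝ) :
    MatHasDerivAt (S.auxOf Y).Ω₃ ((S.auxField (S.auxOf Y)).Ω₃ τ) τ := by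
  have := S.matHasDerivAt_convolution hY 0 τ
  simp only [sub_zero, neg_zero, zero_smul, NormedSpace.exp_zero, Matrix.mul_one] at this
  exact this.congr_deriv (sub_eq_neg_add _ _)

theorem matHasDerivAt_auxOf_Ω₄ {Y : ℝ → Matrix (Fin n) (Fin n) ℝ} (hY : Continuous Y) (τ : ℝ) :
    MatHasDerivAt (S.auxOf Y).Ω₄ ((S.auxField (S.auxOf Y)).Ω₄ τ) τ := by
  refine (S.matHasDerivAt_convolution hY S.h τ).neg.congr_deriv ?_
  simp only [auxField, auxOf, CdExp, neg_smul, Matrix.neg_mul]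
  abel

theorem matHasDerivAt_auxOf_Ω₅ {Y : ℝ → Matrix (Fin n) (Fin n) ℝ} (hY : Continuous Y) (τ : ℝ) :
    MatHasDerivAt (S.auxOf Y).Ω₅ ((S.auxField (S.auxOf Y)).Ω₅ τ) τ := by
  have h := (S.matHasDerivAt_auxOf_Ω₄ (continuous_timeReversal hY) (S.h - τ)).reflect.transpose
  have h2 := S.auxField_auxReversal (S.auxOf (timeReversal Y))
  rw [auxReversal_auxOf, timeReversal_timeReversal] at h2
  rw [h2]
  exact h

theorem matHasDerivAt_auxOf_Ω₆ {Y : ℝ → Matrix (Fin n) (Fin n) ℝ} (hY : Continuous Y) (τ : ℝ) :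
    MatHasDerivAt (S.auxOf Y).Ω₆ ((S.auxField (S.auxOf Y)).Ω₆ τ) τ := by
  have h := (S.matHasDerivAt_auxOf_Ω₃ (continuous_timeReversal hY) (S.h - τ)).reflect.transpose
  have h2 := S.auxField_auxReversal (S.auxOf (timeReversal Y))
  rw [auxReversal_auxOf, timeReversal_timeReversal] at h2
  rw [h2]
  exact h

theorem boundaryConditions_auxOf (Y : ℝ → Matrix (Fin n) (Fin n) ℝ) :
    S.BoundaryConditions (S.auxOf Y) where
  boundary₁₂ := by simp [auxOf]
  boundary₃ := S.convolution_zero Y 0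
  boundary₄ := by simp [auxOf, convolution_zero]
  boundary₅ := by simp [auxOf, convolution_zero]
  boundary₆ := by simp [auxOf, convolution_zero]

/-- A function that solves the delay equation on `[0, h]` together with its time reversal gives a
solution of the auxiliary boundary value problem. -/
theorem bdryMatrix_mulVec_auxOf {Y : ℝ → Matrix (Fin n) (Fin n) ℝ} (hY : Continuous Y)
    (h₁ : ∀ τ ∈ Set.Icc 0 S.h, MatHasDerivWithinAt Y (S.delayOp Y τ) (Set.Icc 0 S.h) τ)
    (h₂ : ∀ τ ∈ Set.Icc 0 S.h, MatHasDerivWithinAt (timeReversal Y)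
      (S.delayOp (timeReversal Y) τ) (Set.Icc 0 S.h) τ)
    {Q : Matrix (Fin n) (Fin n) ℝ}
    (hQ : S.delayOp Y 0 + (S.delayOp (timeReversal Y) 0)ᵀ = -Q) :
    (∀ τ ∈ Set.Icc 0 S.h, (S.auxOf Y).stacked τ = S.flow τ *ᵥ (S.auxOf Y).stacked 0) ∧
      S.bdryMatrix *ᵥ (S.auxOf Y).stacked 0 = boundaryRhs d Q := by
  refine S.bdryMatrix_mulVec_of_Icc (fun τ hτ => ?_) (S.boundaryConditions_auxOf Y) ?_
  · refine AuxTrajectory.hasDerivWithinAt_stacked_iff.2 ⟨?_, ?_,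
      (S.matHasDerivAt_auxOf_Ω₃ hY τ).within _, (S.matHasDerivAt_auxOf_Ω₄ hY τ).within _,
      (S.matHasDerivAt_auxOf_Ω₅ hY τ).within _, (S.matHasDerivAt_auxOf_Ω₆ hY τ).within _⟩
    · rw [S.auxField_auxOf_Ω₁ hY]
      exact h₁ τ hτ
    · rw [S.auxField_auxOf_Ω₂ hY]
      have hτ' : S.h - τ ∈ Set.Icc 0 S.h := ⟨by linarith [hτ.2], by linarith [hτ.1]⟩
      intro i j
      have hc : HasDerivWithinAt (fun t => S.h - t) (-1) (Set.Icc 0 S.h) τ :=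
        ((hasDerivAt_id τ).const_sub S.h).hasDerivWithinAt
      have := (h₂ _ hτ' j i).scomp τ hc fun t ht =>
        (⟨by linarith [ht.2], by linarith [ht.1]⟩ : S.h - t ∈ Set.Icc 0 S.h)
      simpa [Function.comp_def, timeReversal, auxOf] using this
  · rw [S.auxField_auxOf_Ω₁ hY, S.auxField_auxOf_Ω₂ hY, sub_self, sub_neg_eq_add, hQ]

end DelaySystem

/-! ### Solutions of the auxiliary system as solutions of the delay equation -/

namespace DelaySystem

variable {n d : ℕ} (S : DelaySystem n d)

/-- Solutions of the differential equations and the boundary conditions of the auxiliary system,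
without the algebraic condition. -/
structure SolvesBoundary (ω : AuxTrajectory n d) : Prop where
  ode : ∀ τ, HasDerivAt ω.stacked ((S.auxField ω).stacked τ) τ
  boundary : S.BoundaryConditions ω

/-- The function on `[-h, h]` obtained by attaching `Ω₁`, on `[0, h]`, to `Ω₂(· + h)`, on
`[-h, 0]`. -/
def gluing (ω : AuxTrajectory n d) (t : ℝ) : Matrix (Fin n) (Fin n) ℝ :=
  if 0 ≤ t then ω.Ω₁ t else ω.Ω₂ (t + S.h)

variable {S} {ω : AuxTrajectory n d}

theorem gluing_of_nonneg {t : ℝ} (ht : 0 ≤ t) : S.gluing ω t = ω.Ω₁ t := if_pos ht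

theorem gluing_of_nonpos (hb : S.BoundaryConditions ω) {t : ℝ} (ht : t ≤ 0) :
    S.gluing ω t = ω.Ω₂ (t + S.h) := by
  rcases ht.eq_or_lt with rfl | h
  · rw [gluing_of_nonneg le_rfl, hb.boundary₁₂, zero_add]
  · exact if_neg (not_le.2 h)

theorem gluing_auxReversal (hb : S.BoundaryConditions ω) :
    S.gluing (S.auxReversal ω) = timeReversal (S.gluing ω) := by
  funext t
  rw [timeReversal]
  by_cases ht : 0 ≤ t
  · rw [gluing_of_nonneg ht, gluing_of_nonpos hb (by linarith), neg_add_eq_sub]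
    rfl
  · rw [gluing, if_neg ht, gluing_of_nonneg (by linarith)]
    simp [auxReversal]

/-- A function with `f' = -f A` on a convex set that vanishes at one point of it is zero. -/
theorem eq_zero_of_deriv_eq_neg_mul {p q : ℕ} {A : Matrix (Fin q) (Fin q) ℝ} {s : Set ℝ}
    (hs : Convex ℝ s) {f f' : ℝ → Matrix (Fin p) (Fin q) ℝ} (hf : ∀ τ, MatHasDerivAt f (f' τ) τ)
    (hf' : ∀ τ ∈ s, f' τ = -(f τ * A)) {a b : ℝ} (ha : a ∈ s) (hb : b ∈ s) (h0 : f a = 0) :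
    f b = 0 := by
  have hc : ∀ τ ∈ s, MatHasDerivWithinAt (fun t => f t * NormedSpace.exp (t • A)) 0 s τ := by
    intro τ hτ
    refine (((hf τ).mul (matHasDerivAt_exp_smul A τ)).congr_deriv ?_).within s
    rw [hf' τ hτ, Matrix.neg_mul, Matrix.mul_assoc, neg_add_cancel]
  have h1 := matrix_eq_of_deriv_eq_zero hs hc ha hb
  have h2 : f b * NormedSpace.exp (b • A) * NormedSpace.exp ((-b) • A) = 0 := by
    rw [h1, h0, Matrix.zero_mul, Matrix.zero_mul]
  rwa [Matrix.mul_assoc, ← exp_add_smul, add_neg_cancel, zero_smul, NormedSpace.exp_zero,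
    Matrix.mul_one] at h2

namespace SolvesBoundary

theorem ode' (hω : S.SolvesBoundary ω) (τ : ℝ) :
    MatHasDerivAt ω.Ω₁ ((S.auxField ω).Ω₁ τ) τ ∧ MatHasDerivAt ω.Ω₂ ((S.auxField ω).Ω₂ τ) τ ∧
    MatHasDerivAt ω.Ω₃ ((S.auxField ω).Ω₃ τ) τ ∧ MatHasDerivAt ω.Ω₄ ((S.auxField ω).Ω₄ τ) τ ∧
    MatHasDerivAt ω.Ω₅ ((S.auxField ω).Ω₅ τ) τ ∧ MatHasDerivAt ω.Ω₆ ((S.auxField ω).Ω₆ τ) τ := by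
  simpa only [matHasDerivWithinAt_univ] using
    AuxTrajectory.hasDerivWithinAt_stacked_iff.1 (hasDerivWithinAt_univ.2 (hω.ode τ))

theorem auxReversal (hω : S.SolvesBoundary ω) : S.SolvesBoundary (S.auxReversal ω) where
  ode τ := by
    rw [← hasDerivWithinAt_univ, AuxTrajectory.hasDerivWithinAt_stacked_iff,
      auxField_auxReversal]
    obtain ⟨h1, h2, h3, h4, h5, h6⟩ := hω.ode' (S.h - τ)
    exact ⟨h2.reflect.transpose.within _, h1.reflect.transpose.within _,
      h6.reflect.transpose.within _, h5.reflect.transpose.within _,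
      h4.reflect.transpose.within _, h3.reflect.transpose.within _⟩
  boundary :=
    { boundary₁₂ := by simp [DelaySystem.auxReversal, hω.boundary.boundary₁₂]
      boundary₃ := by simp [DelaySystem.auxReversal, hω.boundary.boundary₆]
      boundary₄ := by simp [DelaySystem.auxReversal, hω.boundary.boundary₅]
      boundary₅ := by simp [DelaySystem.auxReversal, hω.boundary.boundary₄]
      boundary₆ := by simp [DelaySystem.auxReversal, hω.boundary.boundary₃] }

theorem continuous_gluing (hω : S.SolvesBoundary ω) : Continuous (S.gluing ω) := by
  refine Continuous.if_le (MatHasDerivAt.continuous fun τ => (hω.ode' τ).1)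
    ((MatHasDerivAt.continuous fun τ => (hω.ode' τ).2.1).comp (continuous_add_const S.h))
    continuous_const continuous_id fun t ht => ?_
  subst ht
  simp [hω.boundary.boundary₁₂]

theorem Ω₁_eq {τ : ℝ} (hτ : τ ∈ Set.Icc 0 S.h) :
    ω.Ω₁ τ = (S.auxOf (S.gluing ω)).Ω₁ τ := (gluing_of_nonneg hτ.1).symm

theorem Ω₂_eq (hω : S.SolvesBoundary ω) {τ : ℝ} (hτ : τ ∈ Set.Icc 0 S.h) :
    ω.Ω₂ τ = (S.auxOf (S.gluing ω)).Ω₂ τ := by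
  simp only [auxOf]
  rw [gluing_of_nonpos hω.boundary (by linarith [hτ.2]), sub_add_cancel]

theorem Ω₃_eq (hω : S.SolvesBoundary ω) {τ : ℝ} (hτ : τ ∈ Set.Icc 0 S.h) :
    ω.Ω₃ τ = (S.auxOf (S.gluing ω)).Ω₃ τ := by
  refine sub_eq_zero.1 (eq_zero_of_deriv_eq_neg_mul (A := S.Ad) (convex_Icc 0 S.h)
    (fun t => (hω.ode' t).2.2.1.sub (S.matHasDerivAt_auxOf_Ω₃ hω.continuous_gluing t))
    (fun t ht => ?_) ⟨le_rfl, S.h_nonneg⟩ hτ ?_)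
  · simp only [auxField, Matrix.sub_mul]
    rw [Ω₁_eq (ω := ω) ht]
    abel
  · rw [hω.boundary.boundary₃, (S.boundaryConditions_auxOf _).boundary₃, sub_zero]

theorem Ω₄_eq (hω : S.SolvesBoundary ω) {τ : ℝ} (hτ : τ ∈ Set.Icc 0 S.h) :
    ω.Ω₄ τ = (S.auxOf (S.gluing ω)).Ω₄ τ := by
  refine sub_eq_zero.1 (eq_zero_of_deriv_eq_neg_mul (A := S.Ad) (convex_Icc 0 S.h)
    (fun t => (hω.ode' t).2.2.2.1.sub (S.matHasDerivAt_auxOf_Ω₄ hω.continuous_gluing t))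
    (fun t ht => ?_) ⟨S.h_nonneg, le_rfl⟩ hτ ?_)
  · simp only [auxField, hω.Ω₂_eq ht, Matrix.sub_mul]
    abel
  · rw [hω.boundary.boundary₄, (S.boundaryConditions_auxOf _).boundary₄, sub_zero]

/-- On `[0, h]`, a solution of the auxiliary boundary value problem is determined by `Ω₁` and
`Ω₂`, joined to one function on `[-h, h]`. -/
theorem stacked_eq (hω : S.SolvesBoundary ω) {τ : ℝ} (hτ : τ ∈ Set.Icc 0 S.h) :
    ω.stacked τ = (S.auxOf (S.gluing ω)).stacked τ := by
  have hτ' : S.h - τ ∈ Set.Icc 0 S.h := ⟨by linarith [hτ.2], by linarith [hτ.1]⟩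
  have h5 := hω.auxReversal.Ω₄_eq hτ'
  have h6 := hω.auxReversal.Ω₃_eq hτ'
  rw [gluing_auxReversal hω.boundary, ← auxReversal_auxOf] at h5 h6
  simp only [DelaySystem.auxReversal, sub_sub_cancel, Matrix.transpose_inj] at h5 h6
  exact AuxTrajectory.stacked_eq_iff.2
    ⟨Ω₁_eq hτ, hω.Ω₂_eq hτ, hω.Ω₃_eq hτ, hω.Ω₄_eq hτ, h5, h6⟩

theorem auxField_stacked_eq (hω : S.SolvesBoundary ω) {τ : ℝ} (hτ : τ ∈ Set.Icc 0 S.h) :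
    (S.auxField ω).stacked τ = (S.auxField (S.auxOf (S.gluing ω))).stacked τ := by
  rw [← E_mulVec_stacked, ← E_mulVec_stacked, hω.stacked_eq hτ]

theorem auxField_Ω₁ (hω : S.SolvesBoundary ω) {τ : ℝ} (hτ : τ ∈ Set.Icc 0 S.h) :
    (S.auxField ω).Ω₁ τ = S.delayOp (S.gluing ω) τ := by
  rw [← S.auxField_auxOf_Ω₁ hω.continuous_gluing]
  exact (AuxTrajectory.stacked_eq_iff.1 (hω.auxField_stacked_eq hτ)).1

theorem auxField_Ω₂ (hω : S.SolvesBoundary ω) {τ : ℝ} (hτ : τ ∈ Set.Icc 0 S.h) :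
    (S.auxField ω).Ω₂ τ = -(S.delayOp (timeReversal (S.gluing ω)) (S.h - τ))ᵀ := by
  rw [← S.auxField_auxOf_Ω₂ hω.continuous_gluing]
  exact (AuxTrajectory.stacked_eq_iff.1 (hω.auxField_stacked_eq hτ)).2.1

end SolvesBoundary

theorem IsODEcSolution.solvesBoundary {Q : Matrix (Fin n) (Fin n) ℝ}
    (h : S.IsODEcSolution Q ω) : S.SolvesBoundary ω :=
  ⟨(isODEcSolution_iff.1 h).1, (isODEcSolution_iff.1 h).2.1⟩

theorem IsODEcSolution.jump {Q : Matrix (Fin n) (Fin n) ℝ} (h : S.IsODEcSolution Q ω) :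
    (S.auxField ω).Ω₁ 0 - (S.auxField ω).Ω₂ S.h = -Q := (isODEcSolution_iff.1 h).2.2

theorem SolvesBoundary.isODEcSolution {Q : Matrix (Fin n) (Fin n) ℝ} (h : S.SolvesBoundary ω)
    (hQ : (S.auxField ω).Ω₁ 0 - (S.auxField ω).Ω₂ S.h = -Q) : S.IsODEcSolution Q ω :=
  isODEcSolution_iff.2 ⟨h.ode, h.boundary, hQ⟩

theorem IsODEcSolution.auxReversal {Q : Matrix (Fin n) (Fin n) ℝ} (h : S.IsODEcSolution Q ω) :
    S.IsODEcSolution Qᵀ (S.auxReversal ω) := by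
  refine h.solvesBoundary.auxReversal.isODEcSolution ?_
  rw [auxField_auxReversal, ← Matrix.transpose_neg, ← h.jump]
  simp [DelaySystem.auxReversal]
  abel

/-! ### Differentiation of homogeneous solutions -/

variable (S) in
/-- The trajectory of the auxiliary system that belongs to the derivative of the glued function.
The derivatives of `Ω₃, …, Ω₆` need a correction, because the intervals `[0, τ]` and `[τ - h, 0]`
of the convolutions keep the endpoint `0` fixed. -/
def auxDerivative (ω : AuxTrajectory n d) : AuxTrajectory n d where
  Ω₁ := (S.auxField ω).Ω₁
  Ω₂ := (S.auxField ω).Ω₂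
  Ω₃ τ := (S.auxField ω).Ω₃ τ - ω.Ω₁ 0 * S.Cd * NormedSpace.exp ((-τ) • S.Ad)
  Ω₄ τ := (S.auxField ω).Ω₄ τ + ω.Ω₁ 0 * S.Cd * NormedSpace.exp ((-τ) • S.Ad)
  Ω₅ τ := (S.auxField ω).Ω₅ τ - (S.CdExp * NormedSpace.exp (τ • S.Ad))ᵀ * ω.Ω₁ 0
  Ω₆ τ := (S.auxField ω).Ω₆ τ + (S.CdExp * NormedSpace.exp (τ • S.Ad))ᵀ * ω.Ω₁ 0

theorem CdExp_mul_exp : S.CdExp * NormedSpace.exp (S.h • S.Ad) = S.Cd := by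
  rw [CdExp, ← neg_smul, Matrix.mul_assoc, ← exp_add_smul, neg_add_cancel, zero_smul,
    NormedSpace.exp_zero, Matrix.mul_one]

theorem SolvesBoundary.hasDerivAt_auxField (hω : S.SolvesBoundary ω) (τ : ℝ) :
    HasDerivAt (S.auxField ω).stacked ((S.auxField (S.auxField ω)).stacked τ) τ := by
  rw [← E_mulVec_stacked]
  have h1 : (S.auxField ω).stacked = fun t => S.E *ᵥ ω.stacked t :=
    funext fun t => (S.E_mulVec_stacked ω t).symm
  rw [h1, hasDerivAt_pi]
  intro i
  have := HasDerivAt.fun_sum fun k (_ : k ∈ Finset.univ) =>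
    (hasDerivAt_pi.1 (hω.ode τ) k).const_mul (S.E i k)
  simpa only [Matrix.mulVec, dotProduct, ← E_mulVec_stacked] using this

theorem auxDerivative_ode (hω : S.SolvesBoundary ω) (τ : ℝ) :
    HasDerivAt (S.auxDerivative ω).stacked ((S.auxField (S.auxDerivative ω)).stacked τ) τ := by
  have h := AuxTrajectory.hasDerivWithinAt_stacked_iff.1
    (hasDerivWithinAt_univ.2 (hω.hasDerivAt_auxField τ))
  simp only [matHasDerivWithinAt_univ] at h
  obtain ⟨h1, h2, h3, h4, h5, h6⟩ := h
  have hX := (matHasDerivAt_exp_neg_smul S.Ad τ).const_mul (ω.Ω₁ 0 * S.Cd)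
  have hZ := ((matHasDerivAt_exp_smul S.Ad τ).const_mul S.CdExp).transpose.mul_const (ω.Ω₁ 0)
  rw [← hasDerivWithinAt_univ, AuxTrajectory.hasDerivWithinAt_stacked_iff]
  simp only [matHasDerivWithinAt_univ]
  refine ⟨h1.congr_deriv ?_, h2.congr_deriv ?_, (h3.sub hX).congr_deriv ?_,
    (h4.add hX).congr_deriv ?_, (h5.sub hZ).congr_deriv ?_, (h6.add hZ).congr_deriv ?_⟩
  · simp only [auxField, auxDerivative, Matrix.add_mul, Matrix.sub_mul]
    abel
  · simp only [auxField, auxDerivative, Matrix.mul_add, Matrix.mul_sub]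
    abel
  · simp only [auxField, auxDerivative, Matrix.sub_mul, Matrix.mul_neg, Matrix.mul_assoc]
    abel
  · simp only [auxField, auxDerivative, Matrix.add_mul, Matrix.mul_neg, Matrix.mul_assoc]
    abel
  · rw [← exp_smul_mul_self_comm]
    simp only [auxField, auxDerivative, Matrix.mul_sub, Matrix.transpose_mul, Matrix.mul_assoc]
    abel
  · rw [← exp_smul_mul_self_comm]
    simp only [auxField, auxDerivative, Matrix.mul_add, Matrix.transpose_mul, Matrix.mul_assoc]
    abel

theorem auxDerivative_solvesBoundary (hω : S.IsODEcSolution 0 ω) :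
    S.SolvesBoundary (S.auxDerivative ω) := by
  have hb := hω.solvesBoundary.boundary
  refine ⟨auxDerivative_ode hω.solvesBoundary, ?_, ?_, ?_, ?_, ?_⟩
  · exact sub_eq_zero.1 (hω.jump.trans neg_zero)
  · simp [auxDerivative, auxField, hb.boundary₃]
  · simp [auxDerivative, auxField, hb.boundary₄, hb.boundary₁₂, CdExp, Matrix.mul_assoc]
  · simp [auxDerivative, auxField, hb.boundary₅]
  · simp only [auxDerivative, CdExp_mul_exp]
    simp [auxField, hb.boundary₆, hb.boundary₁₂]

theorem delayOp_neg (Y : ℝ → Matrix (Fin n) (Fin n) ℝ) (t : ℝ) :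
    S.delayOp (fun s => -Y s) t = -S.delayOp Y t := by
  have h : matIntegral (fun θ => -Y (t + θ) * S.AD θ) (-S.h) 0 =
      -matIntegral (fun θ => Y (t + θ) * S.AD θ) (-S.h) 0 := by
    ext i j
    simp [matIntegral]
  rw [delayOp, delayOp, h]
  simp only [Matrix.neg_mul]
  abel

/-- The homogeneous solutions of the auxiliary boundary value problem are closed under
differentiation. The algebraic condition for the derivative is the equality of the one-sided
second derivatives of the glued function `Y` at `0`. As `Y'` is the delay operator applied to `Y`
on `[0, h]` and minus the advance operator applied to `Y` on `[-h, 0]`, this is the commutation of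
the two operators. -/
theorem isODEcSolution_auxDerivative (hω : S.IsODEcSolution 0 ω) :
    S.IsODEcSolution 0 (S.auxDerivative ω) := by
  have hs := hω.solvesBoundary
  have hd := auxDerivative_solvesBoundary hω
  have hh := S.h_nonneg
  refine hd.isODEcSolution ?_
  rw [hd.auxField_Ω₁ ⟨le_rfl, hh⟩, hd.auxField_Ω₂ ⟨hh, le_rfl⟩]
  have h1 : S.delayOp (S.gluing (S.auxDerivative ω)) 0 =
      -S.delayOp (S.advanceOp (S.gluing ω)) 0 := by
    rw [← delayOp_neg]
    refine S.delayOp_congr fun t ht => ?_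
    rw [gluing_of_nonpos hd.boundary ht.2]
    change (S.auxField ω).Ω₂ (t + S.h) = _
    rw [hs.auxField_Ω₂ ⟨by linarith [ht.1], by linarith [ht.2]⟩, sub_add_cancel_right]
    rfl
  have h2 : S.delayOp (timeReversal (S.gluing (S.auxDerivative ω))) (S.h - S.h) =
      (S.advanceOp (S.delayOp (S.gluing ω)) 0)ᵀ := by
    rw [sub_self, advanceOp, timeReversal, Matrix.transpose_transpose, neg_zero]
    refine S.delayOp_congr fun t ht => congrArg Matrix.transpose ?_
    rw [gluing_of_nonneg (by linarith [ht.2])]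
    exact hs.auxField_Ω₁ ⟨by linarith [ht.2], by linarith [ht.1]⟩
  rw [h1, h2, S.delayOp_advanceOp_comm hs.continuous_gluing]
  simp

end DelaySystem

/-! ### Exponential solutions and the characteristic matrix -/

/-- The real part of the exponential function `t ↦ e^{z t} M`. -/
def expRe {n : ℕ} (z : ℂ) (M : Matrix (Fin n) (Fin n) ℂ) (t : ℝ) : Matrix (Fin n) (Fin n) ℝ :=
  (Complex.exp (z * t) • M).map Complex.re

section ExpRe

variable {n : ℕ} {z : ℂ} {M : Matrix (Fin n) (Fin n) ℂ}

theorem timeReversal_expRe : timeReversal (expRe z M) = expRe (-z) Mᵀ := by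
  funext t
  ext i j
  simp [timeReversal, expRe]

theorem expRe_zero : expRe z M 0 = M.map Complex.re := by
  simp [expRe]

theorem matHasDerivAt_expRe (z : ℂ) (M : Matrix (Fin n) (Fin n) ℂ) (t : ℝ) :
    MatHasDerivAt (expRe z M) (expRe z (z • M) t) t := fun i j => by
  have h : HasDerivAt (fun s : ℝ => Complex.exp (z * s) * M i j)
      (Complex.exp (z * t) * (z * M i j)) t := by
    have h1 : HasDerivAt (fun s : ℝ => z * (s : ℂ)) z t := by
      simpa using (hasDerivAt_id t).ofReal_comp.const_mul z
    simpa [mul_assoc] using h1.cexp.mul_const (M i j)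
  exact (Complex.reCLM.hasFDerivAt.comp_hasDerivAt t h)

theorem continuous_expRe : Continuous (expRe z M) :=
  MatHasDerivAt.continuous (matHasDerivAt_expRe z M)

/-- Real and imaginary part of a solution of `w' = (a + b i) w`. -/
theorem eq_expRe_of_deriv {a b : ℝ} {f g : ℝ → Matrix (Fin n) (Fin n) ℝ}
    (hf : ∀ t, MatHasDerivAt f (a • f t - b • g t) t)
    (hg : ∀ t, MatHasDerivAt g (b • f t + a • g t) t)
    (hM : M = (f 0).map Complex.ofReal + Complex.I • (g 0).map Complex.ofReal) (t : ℝ) :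
    f t = expRe (a + b * Complex.I) M t ∧
      g t = expRe (a + b * Complex.I) (-Complex.I • M) t := by
  set z : ℂ := a + b * Complex.I with hz
  -- The function `f + i g` solves a scalar equation in each entry.
  have key : ∀ i j, (f t i j : ℂ) + Complex.I * g t i j = Complex.exp (z * t) * M i j := by
    intro i j
    have hd : ∀ s : ℝ, HasDerivAt
        (fun s : ℝ => Complex.exp (-(z * s)) * ((f s i j : ℂ) + Complex.I * g s i j)) 0 s := by
      intro s
      have h1 : HasDerivAt (fun s : ℝ => -(z * (s : ℂ))) (-z) s := by
        simpa using ((hasDerivAt_id s).ofReal_comp.const_mul z).fun_neg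
      have h2 := ((hf s i j).ofReal_comp).fun_add (((hg s i j).ofReal_comp).const_mul Complex.I)
      refine (h1.cexp.mul h2).congr_deriv ?_
      simp only [Matrix.sub_apply, Matrix.add_apply, Matrix.smul_apply, smul_eq_mul, hz]
      push_cast
      linear_combination (Complex.exp (-((a + b * Complex.I) * s)) * b * g s i j) *
        -Complex.I_mul_I
    have hc := is_const_of_deriv_eq_zero (fun s => (hd s).differentiableAt)
      (fun s => (hd s).deriv) t 0
    simp only [Complex.ofReal_zero, mul_zero, neg_zero, Complex.exp_zero, one_mul] at hc
    rw [hM]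
    simp only [Matrix.add_apply, Matrix.smul_apply, Matrix.map_apply, smul_eq_mul]
    rw [← hc, ← mul_assoc, ← Complex.exp_add, add_neg_cancel, Complex.exp_zero, one_mul]
  constructor <;> ext i j
  · simpa [expRe] using congrArg Complex.re (key i j)
  · have h := congrArg (fun w => (-Complex.I * w).re) (key i j)
    simp only [expRe, Matrix.map_apply, Matrix.smul_apply, smul_eq_mul]
    rw [mul_left_comm, ← h]
    simp

end ExpRe

namespace DelaySystem

variable {n d : ℕ} (S : DelaySystem n d)

theorem map_re_mul_ofReal (X : Matrix (Fin n) (Fin n) ℂ) (A : Matrix (Fin n) (Fin n) ℝ) :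
    (X * A.map Complex.ofReal).map Complex.re = X.map Complex.re * A := by
  ext i j
  simp [Matrix.mul_apply]

/-- On exponential functions, the delay operator differs from the derivative by the
characteristic matrix. -/
theorem delayOp_expRe (z : ℂ) (M : Matrix (Fin n) (Fin n) ℂ) (t : ℝ) :
    S.delayOp (expRe z M) t = expRe z (z • M - M * S.charMatrix z) t := by
  set K : Matrix (Fin n) (Fin n) ℂ := Matrix.of fun i j =>
    ∫ θ in (-S.h)..0, Complex.exp (z * (θ : ℂ)) * ((S.AD θ i j : ℝ) : ℂ) with hK
  have hM : z • M - M * S.charMatrix z = M * S.A₀.map Complex.ofReal +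
      (Complex.exp (-(z * S.h)) • M) * S.A₁.map Complex.ofReal + M * K := by
    rw [charMatrix, ← hK]
    simp only [Matrix.mul_sub, Matrix.mul_smul, Matrix.smul_mul, Matrix.mul_one]
    abel
  have hI : matIntegral (fun θ => expRe z M (t + θ) * S.AD θ) (-S.h) 0 =
      (Complex.exp (z * t) • (M * K)).map Complex.re := by
    ext i j
    have hc : ∀ k, Continuous fun θ : ℝ =>
        Complex.exp (z * (θ : ℂ)) * ((S.AD θ k j : ℝ) : ℂ) := fun k =>
      (Complex.continuous_exp.comp (continuous_const.mul Complex.continuous_ofReal)).mul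
        (Complex.continuous_ofReal.comp (S.continuous_AD.matrix_elem k j))
    have hk : ∀ k, Continuous fun θ : ℝ => Complex.exp (z * t) * M i k *
        (Complex.exp (z * (θ : ℂ)) * ((S.AD θ k j : ℝ) : ℂ)) := fun k =>
      continuous_const.mul (hc k)
    have hs : Continuous fun θ : ℝ => ∑ k, Complex.exp (z * t) * M i k *
        (Complex.exp (z * (θ : ℂ)) * ((S.AD θ k j : ℝ) : ℂ)) :=
      continuous_finsetSum _ fun k _ => hk k
    have h1 : ∀ θ : ℝ, (expRe z M (t + θ) * S.AD θ) i j = Complex.reCLM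
        (∑ k, Complex.exp (z * t) * M i k *
          (Complex.exp (z * (θ : ℂ)) * ((S.AD θ k j : ℝ) : ℂ))) := fun θ => by
      rw [Matrix.mul_apply, map_sum]
      refine Finset.sum_congr rfl fun k _ => ?_
      rw [← mul_assoc, Complex.reCLM_apply, Complex.re_mul_ofReal]
      simp only [expRe, Matrix.map_apply, Matrix.smul_apply, smul_eq_mul]
      rw [Complex.ofReal_add, mul_add, Complex.exp_add, mul_right_comm]
    simp only [matIntegral, Matrix.of_apply, h1]
    rw [ContinuousLinearMap.intervalIntegral_comp_comm _ (hs.intervalIntegrable _ _),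
      intervalIntegral.integral_finsetSum fun k _ => (hk k).intervalIntegrable _ _]
    simp only [intervalIntegral.integral_const_mul, Matrix.map_apply, Matrix.smul_apply,
      Matrix.mul_apply, smul_eq_mul, Finset.mul_sum, Complex.reCLM_apply, hK, Matrix.of_apply,
      mul_assoc]
  have h2 : Complex.exp (z * ((t - S.h : ℝ) : ℂ)) =
      Complex.exp (z * t) * Complex.exp (-(z * S.h)) := by
    rw [← Complex.exp_add]
    push_cast
    ring_nf
  rw [delayOp, hI, hM]
  simp only [expRe]
  rw [h2, ← map_re_mul_ofReal, ← map_re_mul_ofReal, ← Matrix.map_add _ Complex.add_re,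
    ← Matrix.map_add _ Complex.add_re]
  simp only [smul_add, Matrix.smul_mul, mul_smul]

variable {S} in
/-- If the delay operator acts as the derivative, at `0`, on the real and the imaginary part of
`e^{z t} M`, then `M` is annihilated by the characteristic matrix. -/
theorem mem_spectrumSet_of_delayOp {z : ℂ} {M : Matrix (Fin n) (Fin n) ℂ} (hM : M ≠ 0)
    (hre : S.delayOp (expRe z M) 0 = (z • M).map Complex.re)
    (him : S.delayOp (expRe z (-Complex.I • M)) 0 = (-Complex.I • z • M).map Complex.re) :
    z ∈ S.spectrumSet := by
  have h0 : M * S.charMatrix z = 0 := by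
    rw [delayOp_expRe, expRe_zero] at hre him
    ext i j
    apply Complex.ext
    · have := congrFun (congrFun hre i) j
      simpa using this
    · have := congrFun (congrFun him i) j
      rw [smul_comm z, Matrix.smul_mul, ← smul_sub] at this
      simpa using this
  by_contra hz
  refine hM ?_
  have hu : IsUnit (S.charMatrix z).det := isUnit_iff_ne_zero.2 hz
  rw [← Matrix.mul_one M, ← Matrix.mul_nonsing_inv _ hu, ← Matrix.mul_assoc, h0, Matrix.zero_mul]

end DelaySystem

/-- A real endomorphism has a complex eigenvector `x + i y`. -/
theorem exists_complex_eigenvector {V : Type*} [AddCommGroup V] [Module ℝ V]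
    [FiniteDimensional ℝ V] [Nontrivial V] (f : V →ₗ[ℝ] V) :
    ∃ (a b : ℝ) (x y : V), (x ≠ 0 ∨ y ≠ 0) ∧ f x = a • x - b • y ∧ f y = b • x + a • y := by
  let B := Module.finBasis ℝ V
  have : Nonempty (Fin (Module.finrank ℝ V)) := B.index_nonempty
  set A := LinearMap.toMatrix B B f with hA
  obtain ⟨μ, hμ⟩ := Module.End.exists_eigenvalue (Matrix.toLin' (A.map Complex.ofReal))
  obtain ⟨w, hw⟩ := hμ.exists_hasEigenvector
  have hAw : A.map Complex.ofReal *ᵥ w = μ • w := by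
    simpa [Matrix.toLin'_apply] using hw.apply_eq_smul
  have hre : A *ᵥ (fun i => (w i).re) = fun i => (μ * w i).re := by
    funext i
    simpa [Matrix.mulVec, dotProduct] using congrArg Complex.re (congrFun hAw i)
  have him : A *ᵥ (fun i => (w i).im) = fun i => (μ * w i).im := by
    funext i
    simpa [Matrix.mulVec, dotProduct] using congrArg Complex.im (congrFun hAw i)
  have hf : ∀ u : Fin (Module.finrank ℝ V) → ℝ,
      f (B.equivFun.symm u) = B.equivFun.symm (A *ᵥ u) := by
    intro u
    apply B.equivFun.injective
    have := LinearMap.toMatrix_mulVec_repr B B f (B.equivFun.symm u)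
    rw [← B.equivFun_apply, ← B.equivFun_apply, LinearEquiv.apply_symm_apply] at this
    rw [LinearEquiv.apply_symm_apply, ← this]
  refine ⟨μ.re, μ.im, B.equivFun.symm fun i => (w i).re, B.equivFun.symm fun i => (w i).im,
    ?_, ?_, ?_⟩
  · by_contra! h
    simp only [LinearEquiv.map_eq_zero_iff] at h
    exact hw.2 (funext fun i => Complex.ext (congrFun h.1 i) (congrFun h.2 i))
  · rw [hf, hre, ← map_smul, ← map_smul, ← map_sub]
    congr 1
  · rw [hf, him, ← map_smul, ← map_smul, ← map_add]
    congr 1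
    funext i
    simp [add_comm]

/-! ### The boundary matrix and the spectrum condition -/

namespace AuxTrajectory

variable {n d : ℕ}

/-- The linear combination `a ω + b η`. -/
def linComb (a b : ℝ) (ω η : AuxTrajectory n d) : AuxTrajectory n d where
  Ω₁ τ := a • ω.Ω₁ τ + b • η.Ω₁ τ
  Ω₂ τ := a • ω.Ω₂ τ + b • η.Ω₂ τ
  Ω₃ τ := a • ω.Ω₃ τ + b • η.Ω₃ τ
  Ω₄ τ := a • ω.Ω₄ τ + b • η.Ω₄ τ
  Ω₅ τ := a • ω.Ω₅ τ + b • η.Ω₅ τ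
  Ω₆ τ := a • ω.Ω₆ τ + b • η.Ω₆ τ

theorem stacked_linComb (a b : ℝ) (ω η : AuxTrajectory n d) (τ : ℝ) :
    (linComb a b ω η).stacked τ = a • ω.stacked τ + b • η.stacked τ := by
  rw [stacked, Equiv.comp_symm_eq]
  funext x
  rcases x with x | x | x | x | x | x <;>
    simp [stacked, stack₆, linComb, Matrix.vec]

end AuxTrajectory

namespace DelaySystem

variable {n d : ℕ} (S : DelaySystem n d)

theorem trajectory_linComb (a b : ℝ) (v w : Fin (auxDim n d) → ℝ) :
    S.trajectory (a • v + b • w) = .linComb a b (S.trajectory v) (S.trajectory w) := by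
  simp only [trajectory, AuxTrajectory.ofStacked, AuxTrajectory.linComb, Matrix.mulVec_add,
    Matrix.mulVec_smul]
  rfl

theorem auxDerivative_linComb (a b : ℝ) (ω η : AuxTrajectory n d) :
    S.auxDerivative (.linComb a b ω η) =
      .linComb a b (S.auxDerivative ω) (S.auxDerivative η) := by
  simp only [auxDerivative, auxField, AuxTrajectory.linComb, AuxTrajectory.mk.injEq]
  refine ⟨?_, ?_, ?_, ?_, ?_, ?_⟩ <;> funext τ <;>
    simp only [Matrix.add_mul, Matrix.mul_add, Matrix.smul_mul, Matrix.mul_smul, smul_add,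
      smul_sub, smul_neg, neg_add] <;> abel

/-- Differentiation of homogeneous solutions, in terms of initial states. -/
def derivativeMap : (Fin (auxDim n d) → ℝ) →ₗ[ℝ] Fin (auxDim n d) → ℝ where
  toFun v := (S.auxDerivative (S.trajectory v)).stacked 0
  map_add' v w := by
    have h := S.trajectory_linComb 1 1 v w
    rw [one_smul, one_smul] at h
    rw [h, auxDerivative_linComb, AuxTrajectory.stacked_linComb, one_smul, one_smul]
  map_smul' a v := by
    have h := S.trajectory_linComb a 0 v 0
    rw [zero_smul, add_zero] at h
    rw [h, auxDerivative_linComb, AuxTrajectory.stacked_linComb, zero_smul, add_zero]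
    rfl

theorem boundaryRhs_zero : boundaryRhs d (0 : Matrix (Fin n) (Fin n) ℝ) = 0 := by
  rw [boundaryRhs, Equiv.comp_symm_eq]
  funext x
  rcases x with x | x | x | x | x | x <;> simp [stack₆]

variable {S} in
theorem auxDerivative_stacked {v : Fin (auxDim n d) → ℝ} (hv : S.bdryMatrix *ᵥ v = 0) :
    (∀ τ, (S.auxDerivative (S.trajectory v)).stacked τ = S.flow τ *ᵥ S.derivativeMap v) ∧
      S.bdryMatrix *ᵥ S.derivativeMap v = 0 := by
  have h := (S.isODEcSolution_iff_flow _ _).1 (isODEcSolution_auxDerivative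
    (S.isODEcSolution_trajectory (Q := 0) (hv.trans boundaryRhs_zero.symm)))
  rw [boundaryRhs_zero] at h
  exact h

/-- If the boundary matrix is singular, then differentiation has a complex eigenvector in its
kernel. The corresponding solution is `e^{λ t} M` with `M ≠ 0`, and the delay equations for it and
for its time reversal put `λ` and `-λ` into the spectrum. -/
theorem isUnit_of_spectrumCondition (hS : S.SpectrumCondition) : IsUnit S.bdryMatrix := by
  rw [← Matrix.mulVec_injective_iff_isUnit, ← Matrix.coe_mulVecLin,
    ← LinearMap.ker_eq_bot]
  by_contra hker
  have : Nontrivial (LinearMap.ker S.bdryMatrix.mulVecLin) :=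
    Submodule.nontrivial_iff_ne_bot.2 hker
  obtain ⟨a, b, ⟨x, hxB⟩, ⟨y, hyB⟩, hne, hfx, hfy⟩ := exists_complex_eigenvector
    (S.derivativeMap.restrict (p := LinearMap.ker S.bdryMatrix.mulVecLin)
      (q := LinearMap.ker S.bdryMatrix.mulVecLin)
      fun v hv => (auxDerivative_stacked (S := S) hv).2)
  simp only [Ne, Submodule.mk_eq_zero] at hne
  replace hfx : S.derivativeMap x = a • x + (-b) • y := by
    rw [neg_smul, ← sub_eq_add_neg]
    exact congrArg Subtype.val hfx
  replace hfy : S.derivativeMap y = b • x + a • y := congrArg Subtype.val hfy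
  set ω := S.trajectory x with hω
  set η := S.trajectory y with hη
  have hωs : S.IsODEcSolution 0 ω := S.isODEcSolution_trajectory (hxB.trans boundaryRhs_zero.symm)
  have hηs : S.IsODEcSolution 0 η := S.isODEcSolution_trajectory (hyB.trans boundaryRhs_zero.symm)
  have hDω : ∀ τ, (S.auxDerivative ω).stacked τ =
      (AuxTrajectory.linComb a (-b) ω η).stacked τ := fun τ => by
    rw [(auxDerivative_stacked hxB).1, hfx, ← stacked_trajectory, trajectory_linComb]
  have hDη : ∀ τ, (S.auxDerivative η).stacked τ =
      (AuxTrajectory.linComb b a ω η).stacked τ := fun τ => by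
    rw [(auxDerivative_stacked hyB).1, hfy, ← stacked_trajectory, trajectory_linComb]
  simp only [AuxTrajectory.stacked_eq_iff] at hDω hDη
  have hω1 : ∀ τ, (S.auxField ω).Ω₁ τ = a • ω.Ω₁ τ - b • η.Ω₁ τ := fun τ =>
    (hDω τ).1.trans (by simp [AuxTrajectory.linComb, sub_eq_add_neg])
  have hω2 : ∀ τ, (S.auxField ω).Ω₂ τ = a • ω.Ω₂ τ - b • η.Ω₂ τ := fun τ =>
    (hDω τ).2.1.trans (by simp [AuxTrajectory.linComb, sub_eq_add_neg])
  have hη1 : ∀ τ, (S.auxField η).Ω₁ τ = b • ω.Ω₁ τ + a • η.Ω₁ τ := fun τ => (hDη τ).1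
  have hη2 : ∀ τ, (S.auxField η).Ω₂ τ = b • ω.Ω₂ τ + a • η.Ω₂ τ := fun τ => (hDη τ).2.1
  have hωb := hωs.solvesBoundary
  have hηb := hηs.solvesBoundary
  set z : ℂ := a + b * Complex.I with hz
  set M : Matrix (Fin n) (Fin n) ℂ :=
    (ω.Ω₁ 0).map Complex.ofReal + Complex.I • (η.Ω₁ 0).map Complex.ofReal with hM
  have e1 := eq_expRe_of_deriv (a := a) (b := b) (f := ω.Ω₁) (g := η.Ω₁)
    (fun t => hω1 t ▸ (hωb.ode' t).1) (fun t => hη1 t ▸ (hηb.ode' t).1) hM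
  -- The boundary condition `Ω₁(0) = Ω₂(h)` gives `Ω₂(· + h)` the same initial value `M` as `Ω₁`.
  have hshift : ∀ {f : ℝ → Matrix (Fin n) (Fin n) ℝ} {f' t}, MatHasDerivAt f f' (t + S.h) →
      MatHasDerivAt (fun s => f (s + S.h)) f' t := fun hf i j =>
    HasDerivAt.comp_add_const _ S.h (hf i j)
  have e2 := eq_expRe_of_deriv (a := a) (b := b) (f := fun t => ω.Ω₂ (t + S.h))
    (g := fun t => η.Ω₂ (t + S.h))
    (fun t => hω2 (t + S.h) ▸ hshift (hωb.ode' (t + S.h)).2.1)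
    (fun t => hη2 (t + S.h) ▸ hshift (hηb.ode' (t + S.h)).2.1)
    (M := M) (by rw [zero_add, ← hωb.boundary.boundary₁₂, ← hηb.boundary.boundary₁₂])
  rw [← hz] at e1 e2
  have gω : S.gluing ω = expRe z M := by
    funext t
    unfold gluing
    split_ifs
    exacts [(e1 t).1, (e2 t).1]
  have gη : S.gluing η = expRe z (-Complex.I • M) := by
    funext t
    unfold gluing
    split_ifs
    exacts [(e1 t).2, (e2 t).2]
  have hIcc0 : (0 : ℝ) ∈ Set.Icc 0 S.h := ⟨le_rfl, S.h_nonneg⟩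
  have hIcch : S.h ∈ Set.Icc 0 S.h := ⟨S.h_nonneg, le_rfl⟩
  have hM0 : M ≠ 0 := by
    intro h0
    -- A solution whose glued function vanishes is zero, since `Y` determines the whole state.
    have hzero : ∀ {v}, S.SolvesBoundary (S.trajectory v) → S.gluing (S.trajectory v) = 0 →
        v = 0 := by
      intro v hv hg
      have h1 := hv.stacked_eq hIcc0
      have h2 : (S.auxOf 0).stacked 0 = 0 := by
        have hc : ∀ s τ, S.convolution 0 s τ = 0 := fun s τ => by
          have : matIntegral (fun u => (0 : ℝ → Matrix (Fin n) (Fin n) ℝ) u *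
              (S.Cd * NormedSpace.exp (u • S.Ad))) 0 s = 0 := by
            ext i j
            simp [matIntegral]
          rw [convolution, this, Matrix.zero_mul]
        have hr : timeReversal (0 : ℝ → Matrix (Fin n) (Fin n) ℝ) = 0 := rfl
        rw [AuxTrajectory.stacked, Equiv.comp_symm_eq]
        funext x
        rcases x with x | x | x | x | x | x <;>
          simp [stack₆, auxOf, hc, hr]
      rwa [stacked_trajectory_zero, hg, h2] at h1
    rcases hne with hx | hy
    · exact hx (hzero hωb (by rw [gω, h0]; funext t; ext i j; simp [expRe]))
    · exact hy (hzero hηb (by rw [gη, h0]; funext t; ext i j; simp [expRe]))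
  have hω0 : ω.Ω₁ 0 = M.map Complex.re := by rw [(e1 0).1, expRe_zero]
  have hη0 : η.Ω₁ 0 = (-Complex.I • M).map Complex.re := by rw [(e1 0).2, expRe_zero]
  have hzM : a • ω.Ω₁ 0 - b • η.Ω₁ 0 = (z • M).map Complex.re := by
    rw [hω0, hη0]
    ext i j
    simp [hz]
  have hzM' : b • ω.Ω₁ 0 + a • η.Ω₁ 0 = (-Complex.I • z • M).map Complex.re := by
    rw [hω0, hη0]
    ext i j
    simp [hz]
    ring
  refine hS z (mem_spectrumSet_of_delayOp hM0 ?_ ?_)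
    (mem_spectrumSet_of_delayOp (M := Mᵀ) (by simpa using hM0) ?_ ?_)
  · rw [← gω, ← hωb.auxField_Ω₁ hIcc0, hω1, hzM]
  · rw [← gη, ← hηb.auxField_Ω₁ hIcc0, hη1, hzM']
  · have := hωb.auxField_Ω₂ hIcch
    rw [hω2, ← hωb.boundary.boundary₁₂, ← hηb.boundary.boundary₁₂, hzM, sub_self, gω,
      timeReversal_expRe] at this
    rw [← Matrix.transpose_transpose (S.delayOp _ 0), ← neg_eq_iff_eq_neg.2 this]
    ext i j
    simp
  · have := hηb.auxField_Ω₂ hIcch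
    rw [hη2, ← hωb.boundary.boundary₁₂, ← hηb.boundary.boundary₁₂, hzM', sub_self, gη,
      timeReversal_expRe, Matrix.transpose_smul] at this
    rw [← Matrix.transpose_transpose (S.delayOp _ 0), ← neg_eq_iff_eq_neg.2 this]
    ext i j
    simp

/-- A nonzero complex matrix has a complex multiple with nonzero real part. -/
theorem exists_smul_map_re_ne_zero {M : Matrix (Fin n) (Fin n) ℂ} (hM : M ≠ 0) :
    ∃ c : ℂ, (c • M).map Complex.re ≠ 0 := by
  obtain ⟨i, j, hij⟩ : ∃ i j, M i j ≠ 0 := by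
    by_contra! h
    exact hM (Matrix.ext h)
  refine ⟨starRingEnd ℂ (M i j), fun h => hij ?_⟩
  have := congrFun (congrFun h i) j
  rw [Matrix.map_apply, Matrix.smul_apply, smul_eq_mul, ← Complex.normSq_eq_conj_mul_self,
    Complex.ofReal_re] at this
  exact Complex.normSq_eq_zero.1 this

/-- If `λ` and `-λ` are in the spectrum, with left null vectors `w` and `u` of the characteristic
matrices, then the real part of `e^{λ t} c u wᵀ` solves the delay equation together with its time
reversal, and gives an element of the kernel of the boundary matrix. -/
theorem spectrumCondition_of_isUnit (hB : IsUnit S.bdryMatrix) : S.SpectrumCondition := by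
  intro z hz hz'
  obtain ⟨w, hw0, hw⟩ := Matrix.exists_vecMul_eq_zero_iff.2 hz
  obtain ⟨u, hu0, hu⟩ := Matrix.exists_vecMul_eq_zero_iff.2 hz'
  have hN : Matrix.vecMulVec u w ≠ 0 := by
    obtain ⟨i, hi⟩ := Function.ne_iff.1 hu0
    obtain ⟨j, hj⟩ := Function.ne_iff.1 hw0
    exact fun h => mul_ne_zero hi hj (congrFun (congrFun h i) j)
  obtain ⟨c, hc⟩ := exists_smul_map_re_ne_zero hN
  set M := c • Matrix.vecMulVec u w with hM
  have hMz : M * S.charMatrix z = 0 := by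
    rw [hM, Matrix.smul_mul, Matrix.vecMulVec_mul, hw, Matrix.vecMulVec_zero, smul_zero]
  have hMz' : Mᵀ * S.charMatrix (-z) = 0 := by
    rw [hM, Matrix.transpose_smul, Matrix.transpose_vecMulVec, Matrix.smul_mul,
      Matrix.vecMulVec_mul, hu, Matrix.vecMulVec_zero, smul_zero]
  have h1 : ∀ t, S.delayOp (expRe z M) t = expRe z (z • M) t := fun t => by
    rw [delayOp_expRe, hMz, sub_zero]
  have h2 : ∀ t, S.delayOp (timeReversal (expRe z M)) t = expRe (-z) (-z • Mᵀ) t := fun t => by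
    rw [timeReversal_expRe, delayOp_expRe, hMz', sub_zero]
  have hker := (S.bdryMatrix_mulVec_auxOf (Y := expRe z M) (Q := 0) continuous_expRe
    (fun τ _ => h1 τ ▸ (matHasDerivAt_expRe z M τ).within _)
    (fun τ _ => by
      rw [h2, timeReversal_expRe]
      exact (matHasDerivAt_expRe (-z) Mᵀ τ).within _)
    (by
      rw [h1, h2, expRe_zero, expRe_zero]
      ext i j
      simp)).2
  rw [boundaryRhs_zero] at hker
  have h0 : (S.auxOf (expRe z M)).stacked 0 = 0 :=
    Matrix.mulVec_injective_iff_isUnit.2 hB (hker.trans (Matrix.mulVec_zero _).symm)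
  refine hc ?_
  rw [← expRe_zero (z := z)]
  ext i j
  have := congrFun h0 (stateEquiv n d (.inl (j, i)))
  simpa [AuxTrajectory.stacked, stack₆, auxOf, Matrix.vec] using this

/-! ### Delay Lyapunov matrices -/

theorem delayOp_add_transpose {Y : ℝ → Matrix (Fin n) (Fin n) ℝ} (hY : Continuous Y) :
    S.delayOp Y 0 + (S.delayOp (timeReversal Y) 0)ᵀ =
      S.A₀ᵀ * Y 0 + Y 0 * S.A₀ + S.A₁ᵀ * Y S.h + Y (-S.h) * S.A₁
        + matIntegral (fun θ => (S.AD θ)ᵀ * Y (-θ) + Y θ * S.AD θ) (-S.h) 0 := by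
  have h1 := S.advanceOp_apply Y 0
  simp only [zero_sub, zero_add] at h1
  have h2 : (S.delayOp (timeReversal Y) 0)ᵀ = S.advanceOp Y 0 := by
    rw [advanceOp, timeReversal, neg_zero]
  have h3 : Continuous fun θ => (S.AD θ)ᵀ * Y (-θ) :=
    S.continuous_AD.matrix_transpose.matrix_mul (hY.comp continuous_neg)
  rw [h2, h1, matIntegral_add h3 (hY.matrix_mul S.continuous_AD), delayOp]
  simp only [zero_sub, zero_add]
  abel

/-- The auxiliary trajectory of a solution of the delay equation with coupling conditions solves
the auxiliary boundary value problem. Only the values on `[-h, h]` are constrained, so the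
solution is first continued by constants to a continuous function on the line. -/
theorem IsDDEcSolution.exists_stacked {S : DelaySystem n d} {Q : Matrix (Fin n) (Fin n) ℝ}
    {P : ℝ → Matrix (Fin n) (Fin n) ℝ} (hP : S.IsDDEcSolution Q P) :
    ∃ v, S.bdryMatrix *ᵥ v = boundaryRhs d Q ∧
      ∀ τ ∈ Set.Icc 0 S.h, P τ = firstBlock (S.flow τ *ᵥ v) := by
  have hh := S.h_nonneg
  set Y : ℝ → Matrix (Fin n) (Fin n) ℝ := fun t => P (max (-S.h) (min S.h t)) with hYdef
  have hYP : ∀ t ∈ Set.Icc (-S.h) S.h, Y t = P t := fun t ht => by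
    simp only [hYdef, min_eq_right ht.2, max_eq_right ht.1]
  have hsymm : ∀ τ ∈ Set.Icc (-S.h) S.h, P (-τ) = (P τ)ᵀ := fun τ hτ => by
    rcases le_total 0 τ with h | h
    · exact hP.symmetry τ ⟨h, hτ.2⟩
    · have := hP.symmetry (-τ) ⟨by linarith, by linarith [hτ.1]⟩
      rw [neg_neg] at this
      rw [this, Matrix.transpose_transpose]
  -- The projection of the line onto `[-h, h]` is odd, so the symmetry of `P` extends to `Y`.
  have hYrev : timeReversal Y = Y := by
    funext t
    have h1 : max (-S.h) (min S.h (-t)) = -max (-S.h) (min S.h t) := by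
      simp only [max_def, min_def]
      split_ifs <;> linarith
    simp only [timeReversal, hYdef, h1]
    rw [hsymm _ ⟨le_max_left _ _, max_le (by linarith) (min_le_left _ _)⟩,
      Matrix.transpose_transpose]
  have hYc : Continuous Y := by
    have hc1 : ContinuousOn P (Set.Icc 0 S.h) := by
      refine continuousOn_pi.2 fun i => continuousOn_pi.2 fun j => fun τ hτ => ?_
      exact (hP.dynamics τ hτ i j).continuousWithinAt
    have hc2 : ContinuousOn P (Set.Icc (-S.h) 0) := by
      have : ContinuousOn (fun t => (P (-t))ᵀ) (Set.Icc (-S.h) 0) :=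
        (continuous_id.matrix_transpose).comp_continuousOn
          (hc1.comp continuous_neg.continuousOn fun t ht =>
            ⟨by linarith [ht.2], by linarith [ht.1]⟩)
      refine this.congr fun t ht => ?_
      simp only [hsymm t ⟨ht.1, ht.2.trans hh⟩, Matrix.transpose_transpose]
    have hc3 : ContinuousOn P (Set.Icc (-S.h) S.h) := by
      rw [← Set.Icc_union_Icc_eq_Icc (by linarith : -S.h ≤ 0) hh]
      exact hc2.union_of_isClosed hc1 isClosed_Icc isClosed_Icc
    exact hc3.comp_continuous
      (continuous_const.max (continuous_const.min continuous_id))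
      fun t => ⟨le_max_left _ _, max_le (by linarith) (min_le_left _ _)⟩
  have hop : ∀ τ ∈ Set.Icc 0 S.h, S.delayOp Y τ = S.delayOp P τ := fun τ hτ =>
    S.delayOp_congr fun t ht => hYP t ⟨by linarith [ht.1, hτ.1], ht.2.trans hτ.2⟩
  have hode : ∀ τ ∈ Set.Icc 0 S.h,
      MatHasDerivWithinAt Y (S.delayOp Y τ) (Set.Icc 0 S.h) τ := fun τ hτ i j => by
    rw [hop τ hτ]
    refine (hP.dynamics τ hτ i j).congr (fun t ht => ?_) ?_
    · rw [hYP t ⟨by linarith [ht.1], ht.2⟩]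
    · rw [hYP τ ⟨by linarith [hτ.1], hτ.2⟩]
  have hQ : S.delayOp Y 0 + (S.delayOp (timeReversal Y) 0)ᵀ = -Q := by
    have h0 : (0 : ℝ) ∈ Set.Icc (-S.h) S.h := ⟨by linarith, hh⟩
    have hm : -S.h ∈ Set.Icc (-S.h) S.h := ⟨le_rfl, by linarith⟩
    have hp : S.h ∈ Set.Icc (-S.h) S.h := ⟨by linarith, le_rfl⟩
    rw [S.delayOp_add_transpose hYc, hP.algebraic, hYP _ h0, hYP _ hm, hYP _ hp]
    refine congrArg _ (matIntegral_congr fun θ hθ => ?_)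
    rw [Set.uIcc_of_le (by linarith)] at hθ
    rw [hYP θ ⟨hθ.1, hθ.2.trans hh⟩, hYP (-θ) ⟨by linarith [hθ.2], by linarith [hθ.1]⟩]
  obtain ⟨hflow, hb⟩ := S.bdryMatrix_mulVec_auxOf hYc hode (hYrev.symm ▸ hode) hQ
  refine ⟨_, hb, fun τ hτ => ?_⟩
  rw [← hflow τ hτ, ← hYP τ ⟨by linarith [hτ.1], hτ.2⟩]
  ext i j
  simp [firstBlock, AuxTrajectory.stacked, stack₆, auxOf, Matrix.vec]

/-- If the boundary matrix is invertible and `Q` is symmetric, then time reversal fixes the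
solution of the auxiliary boundary value problem. Its glued function is then symmetric and solves
the delay equation. -/
theorem isDDEcSolution_gluing (hB : IsUnit S.bdryMatrix) {Q : Matrix (Fin n) (Fin n) ℝ}
    (hQ : Qᵀ = Q) {v : Fin (auxDim n d) → ℝ} (hv : S.bdryMatrix *ᵥ v = boundaryRhs d Q) :
    S.IsDDEcSolution Q (S.gluing (S.trajectory v)) := by
  set ω := S.trajectory v with hω
  have hωs : S.IsODEcSolution Q ω := S.isODEcSolution_trajectory hv
  have hrs : S.IsODEcSolution Q (S.auxReversal ω) := by
    simpa only [hQ] using hωs.auxReversal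
  have hωb := hωs.solvesBoundary
  obtain ⟨hf, hb⟩ := (S.isODEcSolution_iff_flow _ _).1 hrs
  have hst : ∀ τ, (S.auxReversal ω).stacked τ = ω.stacked τ := fun τ => by
    rw [hf, Matrix.mulVec_injective_iff_isUnit.2 hB (hb.trans hv.symm), stacked_trajectory]
  have hrev : timeReversal (S.gluing ω) = S.gluing ω := by
    rw [← gluing_auxReversal hωb.boundary]
    funext t
    simp only [gluing, (AuxTrajectory.stacked_eq_iff.1 (hst _)).1,
      (AuxTrajectory.stacked_eq_iff.1 (hst _)).2.1]
  refine ⟨fun τ hτ i j => ?_, fun τ _ => ?_, ?_⟩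
  · refine HasDerivWithinAt.congr (f := fun t => ω.Ω₁ t i j) ?_
      (fun t ht => by rw [gluing_of_nonneg ht.1]) (by rw [gluing_of_nonneg hτ.1])
    have := (hωb.ode' τ).1.within (Set.Icc 0 S.h) i j
    rwa [hωb.auxField_Ω₁ hτ] at this
  · have := congrFun hrev τ
    rw [← this, timeReversal, Matrix.transpose_transpose]
  · rw [← S.delayOp_add_transpose hωb.continuous_gluing, ← hωs.jump,
      hωb.auxField_Ω₁ ⟨le_rfl, S.h_nonneg⟩, hωb.auxField_Ω₂ ⟨S.h_nonneg, le_rfl⟩, sub_self,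
      sub_neg_eq_add]

end DelaySystem

end

theorem corollary2 {n d : ℕ} (S : DelaySystem n d) :
    (∀ (Q : Matrix (Fin n) (Fin n) ℝ) (ω : AuxTrajectory n d),
      S.IsODEcSolution Q ω ↔
        (∀ τ : ℝ, ω.stacked τ = S.flow τ *ᵥ ω.stacked 0) ∧
          (S.F₁ + S.F₂ * S.flow S.h) *ᵥ ω.stacked 0 = boundaryRhs d Q) ∧
    (IsUnit (S.F₁ + S.F₂ * S.flow S.h) ↔ S.SpectrumCondition) ∧
    (S.SpectrumCondition → ∀ Q : Matrix (Fin n) (Fin n) ℝ, Qᵀ = Q →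
      ∃ v₀ : Fin (auxDim n d) → ℝ,
        (∀ v, (S.F₁ + S.F₂ * S.flow S.h) *ᵥ v = boundaryRhs d Q ↔ v = v₀) ∧
        ∃ P : ℝ → Matrix (Fin n) (Fin n) ℝ,
          S.IsDDEcSolution Q P ∧
          (∀ P' : ℝ → Matrix (Fin n) (Fin n) ℝ, S.IsDDEcSolution Q P' →
            Set.EqOn P' P (Set.Icc (-S.h) S.h)) ∧
          ∀ τ ∈ Set.Icc 0 S.h, P τ = firstBlock (S.flow τ *ᵥ v₀)) := by
  refine ⟨S.isODEcSolution_iff_flow,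
    ⟨S.spectrumCondition_of_isUnit, S.isUnit_of_spectrumCondition⟩, fun hS Q hQ => ?_⟩
  have hB : IsUnit S.bdryMatrix := S.isUnit_of_spectrumCondition hS
  obtain ⟨v₀, hv₀⟩ := Matrix.mulVec_surjective_iff_isUnit.2 hB (boundaryRhs d Q)
  have huniq : ∀ v, S.bdryMatrix *ᵥ v = boundaryRhs d Q ↔ v = v₀ := fun v =>
    ⟨fun hv => Matrix.mulVec_injective_iff_isUnit.2 hB (hv.trans hv₀.symm), fun hv => hv ▸ hv₀⟩
  have hP := S.isDDEcSolution_gluing hB hQ hv₀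
  have hfirst : ∀ {P' : ℝ → Matrix (Fin n) (Fin n) ℝ}, S.IsDDEcSolution Q P' →
      ∀ τ ∈ Set.Icc 0 S.h, P' τ = firstBlock (S.flow τ *ᵥ v₀) := fun hP' => by
    obtain ⟨v, hv, h⟩ := hP'.exists_stacked
    rwa [(huniq v).1 hv] at h
  refine ⟨v₀, huniq, _, hP, fun P' hP' τ hτ => ?_, hfirst hP⟩
  rcases le_total 0 τ with h | h
  · rw [hfirst hP' τ ⟨h, hτ.2⟩, hfirst hP τ ⟨h, hτ.2⟩]
  · have h' : -τ ∈ Set.Icc 0 S.h := ⟨by linarith, by linarith [hτ.1]⟩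
    have e1 := hP'.symmetry _ h'
    have e2 := hP.symmetry _ h'
    rw [neg_neg] at e1 e2
    rw [e1, e2, hfirst hP' _ h', hfirst hP _ h']
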